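/- Let $d,m,k\ge 1$ be integers and $n=d+m$. Let $K=\prod_{i=1}^d[a_i,b_i]\subset\mathbb R^d$ with $a_i<b_i$ for all $i$, let $f:K\to\mathbb R^m$ be of class $C^2$ (up to the boundary of $K$), and let $M=\{(\alpha,f(\alpha)):\alpha\in K\}\subset\mathbb R^n$. Let $g:[0,\infty)\to[0,\infty)$ be a dimension function, i.e. a nondecreasing continuous function with $\lim_{\rho\to0}g(\rho)=0$, and suppose that $\bar g(\rho):=g(\rho)/\rho^m$ is nondecreasing on $(0,\infty)$. Denote by $\mathcal H^{\bar g}$ the Hausdorff measure with gauge function $\bar g$. Suppose that (I) the series $$\sum_{q=1}^\infty q^n\, g\Big(q^{-1}\big(q^{-1}\log^2 q\big)^{\frac{k}{2m+k}}\Big)$$ converges; and (II) for $\mathcal H^{\bar g}$-almost every $\alpha\in K$, for every $t\in\mathbb R^m\setminus\{0\}$ the $d\times d$ matrix $\big(t\cdot f''(\alpha)[e_i,e_j]\big)_{1\le i,j\le d}$ has rank at least $k$. Then $M$ is of strong Jarník type for convergence with respect to $g$: for every function $\psi:\mathbb N\to[0,\infty)$ (not necessarily monotonic) such that $\sum_{q=1}^\infty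 q^n g(\psi(q)/q)<\infty$ and every $\theta\in\mathbb R^n$, $$\mathcal H^{\bar g}\big(S(\psi,\theta)\cap M\big)=0,$$ where $S(\psi,\theta)$ is the set of $x\in\mathbb R^n$ such that $\|qx-\theta\|<\psi(q)$ for infinitely many $q\in\mathbb N$, and $\|\cdot\|$ denotes the distance to the nearest integer vector in the max norm. -/

import Mathlib

open Set Filter Topology MeasureTheory

/-- A dimension function: a nondecreasing continuous function on `[0, ∞)` with
`g ρ → 0` as `ρ → 0⁺` (so that `g 0 = 0` and `g ≥ 0` on `[0, ∞)`).
Values at negative arguments are irrelevant. -/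
structure IsDimensionFunction (g : ℝ → ℝ) : Prop where
  monotoneOn : MonotoneOn g (Ici 0)
  continuousOn : ContinuousOn g (Ici 0)
  tendsto_zero : Tendsto g (𝓝[>] 0) (𝓝 0)

/-- The function `ḡ(ρ) = g(ρ) / ρ ^ m` attached to `g` and a codimension `m`. -/
noncomputable def gBar (m : ℕ) (g : ℝ → ℝ) (ρ : ℝ) : ℝ := g ρ / ρ ^ m

/-- Hausdorff measure with respect to the gauge function `h`: the supremum over `δ > 0` of
`inf ∑ i, h (diam (U i))` over countable covers by sets `U i` of diameter at most `δ`. Diameters are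
finite for small `δ`, so the value given to sets of infinite diameter does not matter. -/
noncomputable def hausdorffGaugeMeasure {X : Type*} [EMetricSpace X] [MeasurableSpace X]
    [BorelSpace X] (h : ℝ → ℝ) : Measure X :=
  Measure.mkMetric fun r => ENNReal.ofReal (h r.toReal)

/-- Distance from `x` to the nearest integer vector in the max norm
(the norm of `Fin n → ℝ` is the max norm). -/
noncomputable def distNearestInt {n : ℕ} (x : Fin n → ℝ) : ℝ :=
  ⨅ p : Fin n → ℤ, ‖x - fun i => (p i : ℝ)‖

/-- The set `S(ψ, θ)` of points `x` such that `‖q x - θ‖ < ψ(q)` for infinitely many `q`. -/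
def approxSet {n : ℕ} (ψ : ℕ → ℝ) (θ : Fin n → ℝ) : Set (Fin n → ℝ) :=
  {x | ∃ᶠ q : ℕ in atTop, distNearestInt ((q : ℝ) • x - θ) < ψ q}

/-- A set `M` of codimension `m` in `ℝⁿ` is of strong Jarník type for convergence with respect
to `g`. The summand at `q = 0` does not affect summability. -/
def IsStrongJarnikConvergence {n : ℕ} (m : ℕ) (M : Set (Fin n → ℝ)) (g : ℝ → ℝ) : Prop :=
  ∀ ψ : ℕ → ℝ, (∀ q, 0 ≤ ψ q) →
    (Summable fun q : ℕ => (q : ℝ) ^ n * g (ψ q / q)) →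
    ∀ θ : Fin n → ℝ, hausdorffGaugeMeasure (gBar m g) (approxSet ψ θ ∩ M) = 0

/-- The graph `{(α, f α) : α ∈ K}` in `ℝ ^ (d + m)`. -/
def graphOver {d m : ℕ} (K : Set (Fin d → ℝ)) (f : (Fin d → ℝ) → (Fin m → ℝ)) :
    Set (Fin (d + m) → ℝ) :=
  (fun α => Fin.append α (f α)) '' K

/-- The matrix `(t · f''(α)[eᵢ, eⱼ])ᵢⱼ`, the second derivative being taken within `K`
(one-sided on the boundary of `K`). -/
noncomputable def hessianForm {d m : ℕ} (K : Set (Fin d → ℝ)) (f : (Fin d → ℝ) → (Fin m → ℝ))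
    (α : Fin d → ℝ) (t : Fin m → ℝ) : Matrix (Fin d) (Fin d) ℝ :=
  Matrix.of fun i j =>
    t ⬝ᵥ iteratedFDerivWithin ℝ 2 f K α ![Pi.single i 1, Pi.single j 1]

/-! The heart is a counting bound (`exists_card_near_graph_le`): near a point of `K` satisfying the
rank condition, at most `C q ^ d δ ^ m` shifted rational points of denominator `q` lie within about
`δ / q` of the graph, as soon as `δ ^ (2m + k) q ^ k ≥ 1`. This is the expected order of magnitude.
Replacing `ψ q` by the larger of itself and the critical radius `(q⁻¹ log² q) ^ (k / (2m + k))`,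
capped at `1`, puts every `q ≥ 3` in the admissible range, and (I) keeps the series convergent.
Covering by balls of radius `δ / q` then costs `q ^ d δ ^ m ḡ(δ / q) = q ^ (d + m) g(δ / q)` up to a
constant, and the Hausdorff–Cantelli lemma finishes.

For the count, let `ρ = √(δ / q)`. Within `ρ` of `α` the graph is affine up to `O(δ / q)`, so the
rational points there correspond to lattice points in a box of side about `R = qρ = √(qδ)` at which
an affine map with linear part `D α` is `O(δ)`-close to an integer vector. A large sieve inequality
with `J ≈ 1 / δ` frequencies per coordinate (`sum_norm_sq_gram_le`, `card_near_integers_mul_le`)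
bounds their number by exponential sums over the box at the frequencies `(u - v) · D α`.

These sums are then averaged over `α`. The diagonal `u = v` is bounded trivially. For `u ≠ v` a rank
at least `k` makes the gradient of `α ↦ w · f(α)` nondegenerate in `k` coordinates, and a change of
variables saves a factor `R ^ k` in mean square (`lintegral_norm_sq_boxSum_le_of_near`). The average
local count is thus `O(R ^ d (δ ^ m + R ^ (-k)))`. The condition on `δ` says precisely that `R ^
(-k) ≤ δ ^ m`, and division by `ρ ^ d` gives `q ^ d δ ^ m`.

The points violating the rank condition form an `ℋ^ḡ`-null set in `K`, and the Lipschitz map `α ↦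
(α, f α)` keeps it null. -/

/-! ### Elementary properties of the gauges. -/

theorem IsDimensionFunction.apply_zero {g : ℝ → ℝ} (hg : IsDimensionFunction g) : g 0 = 0 := by
  have h1 : Tendsto g (𝓝[>] 0) (𝓝 (g 0)) :=
    (hg.continuousOn 0 self_mem_Ici).mono_left (nhdsWithin_mono _ Ioi_subset_Ici_self)
  exact tendsto_nhds_unique h1 hg.tendsto_zero

theorem IsDimensionFunction.nonneg {g : ℝ → ℝ} (hg : IsDimensionFunction g) {x : ℝ} (hx : 0 ≤ x) :
    0 ≤ g x := by
  rw [← hg.apply_zero]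
  exact hg.monotoneOn self_mem_Ici hx hx

theorem gBar_zero {m : ℕ} (hm : 0 < m) (g : ℝ → ℝ) : gBar m g 0 = 0 := by
  simp [gBar, hm.ne']

theorem gBar_monotoneOn_Ici {m : ℕ} (hm : 0 < m) {g : ℝ → ℝ} (hg : IsDimensionFunction g)
    (h : MonotoneOn (gBar m g) (Ioi 0)) : MonotoneOn (gBar m g) (Ici 0) := by
  intro x hx y hy hxy
  rcases (mem_Ici.1 hx).eq_or_lt with rfl | hx'
  · rw [gBar_zero hm]
    exact div_nonneg (hg.nonneg hy) (pow_nonneg hy _)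
  · exact h hx' (hx'.trans_le hxy) hxy

/-! ### Hausdorff measures with a gauge that need not be doubling. -/

/-- The subcube with index `c` of the cube with centre `x` and radius `r` divided into `M ^ n`
equal cubes. -/
def subcube {n : ℕ} (M : ℕ) (x : Fin n → ℝ) (r : ℝ) (c : Fin n → Fin M) : Set (Fin n → ℝ) :=
  Icc (fun i => x i - r + 2 * r / M * (c i : ℕ)) (fun i => x i - r + 2 * r / M * ((c i : ℕ) + 1))

theorem ediam_subcube_le {n : ℕ} {M : ℕ} (x : Fin n → ℝ) {r : ℝ} (hr : 0 ≤ r)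
    (c : Fin n → Fin M) : Metric.ediam (subcube M x r c) ≤ ENNReal.ofReal (2 * r / M) := by
  refine Metric.ediam_le fun y hy z hz => ?_
  rw [edist_dist]
  refine ENNReal.ofReal_le_ofReal ((dist_pi_le_iff (by positivity)).2 fun i => ?_)
  have h1 := hy.1 i
  have h2 := hy.2 i
  have h3 := hz.1 i
  have h4 := hz.2 i
  simp only at h1 h2 h3 h4
  rw [Real.dist_eq, abs_le]
  constructor <;> linarith

theorem closedBall_subset_iUnion_subcube {n : ℕ} {M : ℕ} (hM : 0 < M) (x : Fin n → ℝ) {r : ℝ}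
    (hr : 0 ≤ r) : Metric.closedBall x r ⊆ ⋃ c, subcube M x r c := by
  intro y hy
  rcases hr.eq_or_lt with rfl | hr
  · refine mem_iUnion.2 ⟨fun _ => ⟨0, hM⟩, ?_⟩
    have : y = x := by simpa using hy
    subst this
    simp [subcube]
  have hM' : (0 : ℝ) < M := by exact_mod_cast hM
  have key : ∀ i, ∃ j : Fin M, x i - r + 2 * r / M * (j : ℕ) ≤ y i ∧
      y i ≤ x i - r + 2 * r / M * ((j : ℕ) + 1) := by
    intro i
    have h1 : |y i - x i| ≤ r := by
      rw [← Real.dist_eq]; exact (dist_le_pi_dist y x i).trans hy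
    rw [abs_le] at h1
    set s : ℝ := (y i - x i + r) * (M / (2 * r)) with hs
    have hs0 : 0 ≤ s := by
      apply mul_nonneg <;> [linarith; positivity]
    have hsM : s ≤ M := by
      have : (y i - x i + r) * (M / (2 * r)) ≤ (2 * r) * (M / (2 * r)) := by
        gcongr; linarith
      rwa [mul_div_cancel₀ _ (by positivity)] at this
    have hy' : y i = x i - r + 2 * r / M * s := by
      rw [hs]; field_simp; ring
    have hp : 0 ≤ 2 * r / M := by positivity
    by_cases hlt : ⌊s⌋₊ < M
    · refine ⟨⟨⌊s⌋₊, hlt⟩, ?_, ?_⟩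
      · rw [hy']; gcongr; exact Nat.floor_le hs0
      · rw [hy']; gcongr; exact (Nat.lt_floor_add_one s).le
    -- On the right-hand face the floor is `M`, out of range; the last subcube is closed and
    -- contains the point.
    · have hle : (M : ℝ) ≤ s := (Nat.le_floor_iff hs0).1 (not_lt.1 hlt)
      have hsM' : s = M := le_antisymm hsM hle
      refine ⟨⟨M - 1, by omega⟩, ?_, ?_⟩
      · rw [hy']; gcongr; rw [hsM']; exact_mod_cast Nat.sub_le _ _
      · rw [hy', hsM']; gcongr
        have : M - 1 + 1 = M := by omega
        exact_mod_cast this.ge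
  choose c hc1 hc2 using key
  exact mem_iUnion.2 ⟨c, fun i => hc1 i, fun i => hc2 i⟩

theorem gauge_ediam_le {h : ℝ → ℝ} (hmono : MonotoneOn h (Ici 0)) {X : Type*}
    [EMetricSpace X] {s : Set X} {r : ℝ} (hr : 0 ≤ r)
    (hs : Metric.ediam s ≤ ENNReal.ofReal r) :
    ENNReal.ofReal (h (Metric.ediam s).toReal) ≤ ENNReal.ofReal (h r) :=
  ENNReal.ofReal_le_ofReal <| hmono ENNReal.toReal_nonneg hr (ENNReal.toReal_le_of_le_ofReal hr hs)

/-- A Lipschitz image of a null set is null for the same gauge, even if the gauge is not doubling: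
sets of diameter `ρ` in `ℝ ^ d` can be divided into boundedly many sets of diameter `ρ / C`. -/
theorem hausdorffGaugeMeasure_image_eq_zero {d n : ℕ} {h : ℝ → ℝ}
    (hmono : MonotoneOn h (Ici 0)) (h0 : h 0 = 0) {F : (Fin d → ℝ) → (Fin n → ℝ)}
    {C : NNReal} {s : Set (Fin d → ℝ)} (hF : LipschitzOnWith C F s)
    (hs : hausdorffGaugeMeasure h s = 0) : hausdorffGaugeMeasure h (F '' s) = 0 := by
  classical
  -- A set of diameter `ρ` lies in a cube of side `2ρ`; its pieces of side `2ρ / M` have images of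
  -- diameter at most `2Cρ / M ≤ ρ`, so the gauge is never evaluated beyond `ρ`.
  obtain ⟨M, hM⟩ := exists_nat_gt (2 * (C : ℝ))
  have hM' : (0 : ℝ) < M := (by positivity : (0:ℝ) ≤ 2 * (C : ℝ)).trans_lt hM
  have hM0 : 0 < M := by exact_mod_cast hM'
  have hcov : ∀ N : ℕ, ∃ t : ℕ → Set (Fin d → ℝ), s ⊆ iUnion t ∧
      (∀ i, Metric.ediam (t i) ≤ ((N : ENNReal) + 1)⁻¹) ∧
      ∑' i, ⨆ _ : (t i).Nonempty, ENNReal.ofReal (h (Metric.ediam (t i)).toReal)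
        < ((N : ENNReal) + 1)⁻¹ := by
    intro N
    have hpos : (0 : ENNReal) < ((N : ENNReal) + 1)⁻¹ := by simp
    have hle := le_iSup₂ (f := fun (r : ENNReal) (_ : 0 < r) =>
        ⨅ (t : ℕ → Set (Fin d → ℝ)) (_ : s ⊆ iUnion t) (_ : ∀ n, Metric.ediam (t n) ≤ r),
          ∑' n, ⨆ _ : (t n).Nonempty, ENNReal.ofReal (h (Metric.ediam (t n)).toReal))
        (((N : ENNReal) + 1)⁻¹) hpos
    have hz := hs
    rw [hausdorffGaugeMeasure, Measure.mkMetric_apply] at hz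
    rw [hz] at hle
    have hlt := hle.trans_lt hpos
    simp only [iInf_lt_iff] at hlt
    obtain ⟨t, h1, h2, h3⟩ := hlt
    exact ⟨t, h1, h2, h3⟩
  choose t ht1 ht2 ht3 using hcov
  let x : ℕ → ℕ → (Fin d → ℝ) := fun N i => if h : (t N i).Nonempty then h.some else 0
  let ρ : ℕ → ℕ → ℝ := fun N i => (Metric.ediam (t N i)).toReal
  have hρ : ∀ N i, 0 ≤ ρ N i := fun N i => ENNReal.toReal_nonneg
  have hfin : ∀ N i, Metric.ediam (t N i) ≠ ⊤ := fun N i =>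
    ((ht2 N i).trans_lt (by simp)).ne
  have hball : ∀ N i, t N i ⊆ Metric.closedBall (x N i) (ρ N i) := by
    intro N i y hy
    have hne : (t N i).Nonempty := ⟨y, hy⟩
    simp only [x, dif_pos hne, Metric.mem_closedBall]
    exact Metric.dist_le_diam_of_mem' (hfin N i) hy hne.some_mem
  -- Intersecting with `s` makes the Lipschitz bound available; intersecting with `t N p.1` makes
  -- the piece empty when the covering set is, where the original sum contributes nothing.
  let u : ∀ N : ℕ, ℕ × (Fin d → Fin M) → Set (Fin n → ℝ) := fun N p =>
    F '' (s ∩ (t N p.1 ∩ subcube M (x N p.1) (ρ N p.1) p.2))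
  have hudiam : ∀ N p, Metric.ediam (u N p) ≤ ENNReal.ofReal (ρ N p.1) := by
    intro N p
    have h0 : Metric.ediam (u N p) ≤ C *
        Metric.ediam (s ∩ (t N p.1 ∩ subcube M (x N p.1) (ρ N p.1) p.2)) := by
      refine Metric.ediam_le ?_
      rintro _ ⟨y, hy, rfl⟩ _ ⟨z, hz, rfl⟩
      exact (hF hy.1 hz.1).trans (by gcongr; exact Metric.edist_le_ediam_of_mem hy hz)
    refine h0.trans ?_
    have h1 : Metric.ediam (s ∩ (t N p.1 ∩ subcube M (x N p.1) (ρ N p.1) p.2)) ≤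
        ENNReal.ofReal (2 * ρ N p.1 / M) :=
      (Metric.ediam_mono (inter_subset_right.trans inter_subset_right)).trans
        (ediam_subcube_le _ (hρ _ _) _)
    calc (C : ENNReal) * _ ≤ ENNReal.ofReal C * ENNReal.ofReal (2 * ρ N p.1 / M) := by
          gcongr; simp
      _ = ENNReal.ofReal (C * (2 * ρ N p.1 / M)) := by
          rw [ENNReal.ofReal_mul]; positivity
      _ ≤ _ := by
          apply ENNReal.ofReal_le_ofReal
          rw [← mul_div_assoc, div_le_iff₀ hM']
          nlinarith [hρ N p.1]
  have hbound : ∀ N, ∑' p, ENNReal.ofReal (h (Metric.ediam (u N p)).toReal) ≤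
      ((M ^ d : ℕ) : ENNReal) * ((N : ENNReal) + 1)⁻¹ := by
    intro N
    have h1 : ∀ p, ENNReal.ofReal (h (Metric.ediam (u N p)).toReal) ≤
        ⨆ _ : (t N p.1).Nonempty, ENNReal.ofReal (h (ρ N p.1)) := by
      intro p
      by_cases hne : (t N p.1).Nonempty
      · rw [iSup_pos hne]
        exact gauge_ediam_le hmono (hρ _ _) (hudiam N p)
      · have : u N p = ∅ := by
          simp [u, not_nonempty_iff_eq_empty.1 hne]
        simp [this, h0]
    calc _ ≤ ∑' p : ℕ × (Fin d → Fin M), ⨆ _ : (t N p.1).Nonempty, ENNReal.ofReal (h (ρ N p.1)) :=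
          ENNReal.tsum_le_tsum h1
      _ = ∑' i, ((M ^ d : ℕ) : ENNReal) * ⨆ _ : (t N i).Nonempty, ENNReal.ofReal (h (ρ N i)) := by
          rw [ENNReal.tsum_prod']
          refine tsum_congr fun i => ?_
          simp [tsum_fintype]
      _ ≤ _ := by
          rw [ENNReal.tsum_mul_left]
          gcongr
          exact (ht3 N).le
  have hlim : Tendsto (fun N : ℕ => ((N : ENNReal) + 1)⁻¹) atTop (𝓝 0) := by
    have := (tendsto_add_atTop_iff_nat 1).2 ENNReal.tendsto_inv_nat_nhds_zero
    simpa using this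
  have hle := Measure.mkMetric_le_liminf_tsum (F '' s) (l := atTop)
    (fun N : ℕ => ((N : ENNReal) + 1)⁻¹) hlim u
    (Eventually.of_forall fun N p => (hudiam N p).trans (by
      rw [ENNReal.ofReal_toReal (hfin _ _)]; exact ht2 N _))
    (Eventually.of_forall fun N => by
      rintro _ ⟨y, hy, rfl⟩
      obtain ⟨i, hi⟩ := mem_iUnion.1 (ht1 N hy)
      obtain ⟨c, hc⟩ := mem_iUnion.1
        (closedBall_subset_iUnion_subcube hM0 (x N i) (hρ N i) (hball N i hi))
      exact mem_iUnion.2 ⟨(i, c), mem_image_of_mem F ⟨hy, hi, hc⟩⟩)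
    (fun r => ENNReal.ofReal (h r.toReal))
  have hlim2 : Tendsto (fun N : ℕ => ((M ^ d : ℕ) : ENNReal) * ((N : ENNReal) + 1)⁻¹) atTop
      (𝓝 0) := by
    have := ENNReal.Tendsto.const_mul hlim (a := ((M ^ d : ℕ) : ENNReal))
      (Or.inr (ENNReal.natCast_ne_top _))
    simpa using this
  refine le_antisymm (hle.trans ?_) bot_le
  rw [← hlim2.liminf_eq]
  exact liminf_le_liminf (Eventually.of_forall hbound)

/-- The Hausdorff–Cantelli lemma for the limit superior of finite families of balls. -/
theorem hausdorffGaugeMeasure_eq_zero_of_summable {n : ℕ} {h : ℝ → ℝ}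
    (hmono : MonotoneOn h (Ici 0)) (h0 : h 0 = 0) {ι : Type*} [Countable ι]
    (P : ℕ → Finset ι) (x : ℕ → ι → (Fin n → ℝ)) {r : ℕ → ℝ} (hr : ∀ q, 0 ≤ r q)
    (hr0 : Tendsto r atTop (𝓝 0)) (hsum : Summable fun q => ((P q).card : ℝ) * h (r q))
    {s : Set (Fin n → ℝ)}
    (hs : ∀ y ∈ s, ∃ᶠ q in atTop, ∃ p ∈ P q, y ∈ Metric.closedBall (x q p) (r q)) :
    hausdorffGaugeMeasure h s = 0 := by
  classical
  -- A ball of radius `r` has diameter up to `2r`, and `h (2r)` is not controlled by `h r`; halving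
  -- each side gives `2 ^ n` cubes of diameter at most `r`.
  let u : ∀ N : ℕ, ℕ × ι × (Fin n → Fin 2) → Set (Fin n → ℝ) := fun N p =>
    if p.2.1 ∈ P (p.1 + N) then subcube 2 (x (p.1 + N) p.2.1) (r (p.1 + N)) p.2.2 else ∅
  have hu : ∀ N p, Metric.ediam (u N p) ≤ ENNReal.ofReal (r (p.1 + N)) := by
    intro N p
    by_cases hp : p.2.1 ∈ P (p.1 + N)
    · simp only [u, if_pos hp]
      refine (ediam_subcube_le _ (hr _) _).trans_eq ?_
      congr 1
      push_cast
      ring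
    · simp [u, if_neg hp]
  let R : ℕ → ENNReal := fun N => ⨆ q : ℕ, ENNReal.ofReal (r (q + N))
  have hR : Tendsto R atTop (𝓝 0) := by
    rw [ENNReal.tendsto_nhds_zero]
    intro ε hε
    have h1 : Tendsto (fun q => ENNReal.ofReal (r q)) atTop (𝓝 0) := by
      simpa using ENNReal.tendsto_ofReal hr0
    obtain ⟨N0, hN0⟩ := eventually_atTop.1 ((ENNReal.tendsto_nhds_zero.1 h1) ε hε)
    filter_upwards [eventually_ge_atTop N0] with N hN
    exact iSup_le fun q => hN0 _ (by omega)
  have hbound : ∀ N, ∑' p, ENNReal.ofReal (h (Metric.ediam (u N p)).toReal) ≤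
      (2 ^ n : ENNReal) * ∑' q, ENNReal.ofReal (((P (q + N)).card : ℝ) * h (r (q + N))) := by
    intro N
    have h1 : ∀ p, ENNReal.ofReal (h (Metric.ediam (u N p)).toReal) ≤
        if p.2.1 ∈ P (p.1 + N) then ENNReal.ofReal (h (r (p.1 + N))) else 0 := by
      intro p
      by_cases hp : p.2.1 ∈ P (p.1 + N)
      · rw [if_pos hp]
        exact gauge_ediam_le hmono (hr _) (hu N p)
      · have : u N p = ∅ := by simp [u, if_neg hp]
        simp [this, h0]
    refine (ENNReal.tsum_le_tsum h1).trans_eq ?_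
    rw [ENNReal.tsum_prod', ← ENNReal.tsum_mul_left]
    refine tsum_congr fun q => ?_
    rw [ENNReal.tsum_prod']
    simp only [tsum_fintype, Finset.sum_const, Finset.card_univ, nsmul_eq_mul]
    rw [ENNReal.tsum_mul_left, tsum_eq_sum (s := P (q + N)) (by
      intro b hb; simp [hb]), Finset.sum_ite_of_true (by simp), Finset.sum_const, nsmul_eq_mul,
      ENNReal.ofReal_mul (by positivity), ENNReal.ofReal_natCast]
    simp
  have hle := Measure.mkMetric_le_liminf_tsum s (l := atTop) R hR u
    (Eventually.of_forall fun N p => (hu N p).trans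
      (le_iSup (fun q => ENNReal.ofReal (r (q + N))) p.1))
    (Eventually.of_forall fun N => by
      intro y hy
      obtain ⟨q, hq, p, hp, hyp⟩ := (frequently_atTop.1 (hs y hy)) N
      obtain ⟨c, hc⟩ := mem_iUnion.1
        (closedBall_subset_iUnion_subcube two_pos (x q p) (hr q) hyp)
      refine mem_iUnion.2 ⟨(q - N, p, c), ?_⟩
      have : q - N + N = q := by omega
      simp only [u, this, if_pos hp]
      exact hc)
    (fun r => ENNReal.ofReal (h r.toReal))
  have htail : Tendsto (fun N : ℕ => (2 ^ n : ENNReal) *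
      ∑' q, ENNReal.ofReal (((P (q + N)).card : ℝ) * h (r (q + N)))) atTop (𝓝 0) := by
    have h1 := ENNReal.tendsto_sum_nat_add
      (fun q => ENNReal.ofReal (((P q).card : ℝ) * h (r q)))
      hsum.tsum_ofReal_ne_top
    have := ENNReal.Tendsto.const_mul h1 (a := (2 ^ n : ENNReal)) (Or.inr (by simp))
    simpa using this
  refine le_antisymm (hle.trans ?_) bot_le
  rw [← htail.liminf_eq]
  exact liminf_le_liminf (Eventually.of_forall hbound)

/-! ### Duality for Gram matrices, characters and Dirichlet kernels. -/

open scoped ComplexConjugate in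
/-- Duality between the two sums of squares attached to a family of rank one Gram matrices. -/
theorem sum_norm_sq_gram_le {ι κ : Type*} (U : Finset ι) (X : Finset κ) (c : ι → ℂ)
    (hc : ∀ u, ‖c u‖ = 1) (z : ι → κ → ℂ) :
    ∑ x ∈ X, ∑ y ∈ X, ‖∑ u ∈ U, c u * (z u x * conj (z u y))‖ ^ 2 ≤
      ∑ u ∈ U, ∑ v ∈ U, ‖∑ x ∈ X, z u x * conj (z v x)‖ ^ 2 := by
  -- The left side is the squared Hilbert–Schmidt norm of `∑ c_u z_u z_u*`; expanding it gives the
  -- squared inner products of the `z_u` with unimodular weights, which the triangle inequality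
  -- removes.
  have key : ((∑ x ∈ X, ∑ y ∈ X, ‖∑ u ∈ U, c u * (z u x * conj (z u y))‖ ^ 2 : ℝ) : ℂ) =
      ∑ u ∈ U, ∑ v ∈ U, c u * conj (c v) *
        ((‖∑ x ∈ X, z u x * conj (z v x)‖ ^ 2 : ℝ) : ℂ) := by
    have h1 : ∀ w : ℂ, ((‖w‖ ^ 2 : ℝ) : ℂ) = w * conj w := fun w => by
      rw [Complex.mul_conj, Complex.normSq_eq_norm_sq]
    simp only [Complex.ofReal_sum, h1, map_sum, Finset.sum_mul_sum, map_mul, Complex.conj_conj]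
    simp only [Finset.mul_sum]
    calc _ = ∑ x ∈ X, ∑ u ∈ U, ∑ y ∈ X, ∑ v ∈ U,
          c u * (z u x * conj (z u y)) * (conj (c v) * (conj (z v x) * z v y)) :=
          Finset.sum_congr rfl fun x _ => Finset.sum_comm
      _ = ∑ u ∈ U, ∑ x ∈ X, ∑ v ∈ U, ∑ y ∈ X,
          c u * (z u x * conj (z u y)) * (conj (c v) * (conj (z v x) * z v y)) := by
          rw [Finset.sum_comm]
          exact Finset.sum_congr rfl fun u _ => Finset.sum_congr rfl fun x _ => Finset.sum_comm
      _ = ∑ u ∈ U, ∑ v ∈ U, ∑ x ∈ X, ∑ y ∈ X,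
          c u * (z u x * conj (z u y)) * (conj (c v) * (conj (z v x) * z v y)) :=
          Finset.sum_congr rfl fun u _ => Finset.sum_comm
      _ = _ := by
          refine Finset.sum_congr rfl fun u _ => Finset.sum_congr rfl fun v _ =>
            Finset.sum_congr rfl fun x _ => Finset.sum_congr rfl fun y _ => ?_
          ring
  have hnn : 0 ≤ ∑ x ∈ X, ∑ y ∈ X, ‖∑ u ∈ U, c u * (z u x * conj (z u y))‖ ^ 2 := by positivity
  rw [← Real.norm_of_nonneg hnn, ← Complex.norm_real, key]
  refine (norm_sum_le _ _).trans (Finset.sum_le_sum fun u _ => (norm_sum_le _ _).trans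
    (Finset.sum_le_sum fun v _ => ?_))
  rw [norm_mul, norm_mul, RCLike.norm_conj, hc, hc, Complex.norm_real,
    Real.norm_of_nonneg (by positivity)]
  simp

/-- The character `x ↦ exp (2πix)`. -/
noncomputable def expTwoPiI (x : ℝ) : ℂ := Complex.exp ((2 * Real.pi * x : ℝ) * Complex.I)

theorem expTwoPiI_add (x y : ℝ) : expTwoPiI (x + y) = expTwoPiI x * expTwoPiI y := by
  rw [expTwoPiI, expTwoPiI, expTwoPiI, ← Complex.exp_add]
  congr 1
  push_cast
  ring

@[simp] theorem norm_expTwoPiI (x : ℝ) : ‖expTwoPiI x‖ = 1 := Complex.norm_exp_ofReal_mul_I _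

theorem expTwoPiI_zero : expTwoPiI 0 = 1 := by simp [expTwoPiI]

theorem expTwoPiI_re (x : ℝ) : (expTwoPiI x).re = Real.cos (2 * Real.pi * x) :=
  Complex.exp_ofReal_mul_I_re _

open scoped ComplexConjugate in
theorem conj_expTwoPiI (x : ℝ) : conj (expTwoPiI x) = expTwoPiI (-x) := by
  rw [expTwoPiI, expTwoPiI, ← Complex.exp_conj]
  congr 1
  rw [map_mul, Complex.conj_I, Complex.conj_ofReal]
  push_cast
  ring

theorem expTwoPiI_intCast (n : ℤ) : expTwoPiI n = 1 := by
  rw [expTwoPiI, ← Complex.exp_int_mul_two_pi_mul_I n]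
  congr 1
  push_cast
  ring

theorem expTwoPiI_sum {ι : Type*} (s : Finset ι) (x : ι → ℝ) :
    expTwoPiI (∑ i ∈ s, x i) = ∏ i ∈ s, expTwoPiI (x i) := by
  classical
  induction s using Finset.induction_on with
  | empty => simp [expTwoPiI_zero]
  | insert a s ha ih => rw [Finset.sum_insert ha, Finset.prod_insert ha, expTwoPiI_add, ih]

theorem continuous_expTwoPiI : Continuous expTwoPiI := by
  unfold expTwoPiI
  fun_prop

/-- The Dirichlet kernel `∑_{0 ≤ l < L} exp (2πily)`. -/
noncomputable def dirichletSum (L : ℕ) (y : ℝ) : ℂ :=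
  ∑ l ∈ Finset.Ico (0 : ℤ) L, expTwoPiI (l * y)

theorem continuous_dirichletSum (L : ℕ) : Continuous (dirichletSum L) := by
  unfold dirichletSum
  exact continuous_finsetSum _ fun l _ => continuous_expTwoPiI.comp (by fun_prop)

theorem norm_dirichletSum_le (L : ℕ) (y : ℝ) : ‖dirichletSum L y‖ ≤ L := by
  refine (norm_sum_le _ _).trans ?_
  simp

/-- The sum of `exp (2πi x·ξ)` over the lattice points `x` of the cube `[0, L) ^ d`. -/
noncomputable def boxSum {d : ℕ} (L : ℕ) (ξ : Fin d → ℝ) : ℂ :=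
  ∑ x ∈ Fintype.piFinset fun _ : Fin d => Finset.Ico (0 : ℤ) L, expTwoPiI (∑ i, x i * ξ i)

theorem boxSum_eq_prod {d : ℕ} (L : ℕ) (ξ : Fin d → ℝ) :
    boxSum L ξ = ∏ i, dirichletSum L (ξ i) := by
  simp only [boxSum, dirichletSum, expTwoPiI_sum]
  rw [Finset.prod_univ_sum]

theorem continuous_boxSum {d : ℕ} (L : ℕ) : Continuous (boxSum L : (Fin d → ℝ) → ℂ) := by
  unfold boxSum
  exact continuous_finsetSum _ fun l _ => continuous_expTwoPiI.comp (by fun_prop)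

theorem norm_sq_dirichletSum (L : ℕ) (y : ℝ) : ‖dirichletSum L y‖ ^ 2 =
    ∑ l ∈ Finset.Ico (0 : ℤ) L, ∑ l' ∈ Finset.Ico (0 : ℤ) L,
      Real.cos (2 * Real.pi * ((l - l' : ℤ) : ℝ) * y) := by
  have h1 : ‖dirichletSum L y‖ ^ 2 =
      (dirichletSum L y * (starRingEnd ℂ) (dirichletSum L y)).re := by
    rw [Complex.mul_conj, Complex.normSq_eq_norm_sq, Complex.ofReal_re]
  rw [h1]
  simp only [dirichletSum, map_sum, Finset.sum_mul_sum, Complex.re_sum, conj_expTwoPiI,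
    ← expTwoPiI_add, expTwoPiI_re]
  refine Finset.sum_congr rfl fun l _ => Finset.sum_congr rfl fun l' _ => ?_
  congr 1
  push_cast
  ring

theorem integral_cos_two_pi_mul_int {r : ℤ} (hr : r ≠ 0) (N : ℕ) :
    ∫ y in (-N : ℝ)..N, Real.cos (2 * Real.pi * r * y) = 0 := by
  have hr' : (r : ℝ) ≠ 0 := by exact_mod_cast hr
  rw [intervalIntegral.integral_comp_mul_left (f := Real.cos)
    (mul_ne_zero (mul_ne_zero two_ne_zero Real.pi_ne_zero) hr'), integral_cos]
  have h1 : Real.sin (2 * Real.pi * r * N) = 0 := by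
    have : 2 * Real.pi * r * N = ((2 * r * N : ℤ) : ℝ) * Real.pi := by push_cast; ring
    rw [this, Real.sin_int_mul_pi]
  rw [mul_neg, Real.sin_neg, h1]
  simp

/-- Orthogonality of characters over `2N` full periods: only the `L` diagonal terms survive. -/
theorem integral_norm_sq_dirichletSum (L N : ℕ) :
    ∫ y in (-N : ℝ)..N, ‖dirichletSum L y‖ ^ 2 = 2 * N * L := by
  simp only [norm_sq_dirichletSum]
  rw [intervalIntegral.integral_finsetSum fun l _ => Continuous.intervalIntegrable (by fun_prop) _ _]
  have : ∀ l ∈ Finset.Ico (0 : ℤ) L, (∫ y in (-N : ℝ)..N, ∑ l' ∈ Finset.Ico (0 : ℤ) L,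
      Real.cos (2 * Real.pi * ((l - l' : ℤ) : ℝ) * y)) = 2 * N := by
    intro l hl
    rw [intervalIntegral.integral_finsetSum
      fun l _ => Continuous.intervalIntegrable (by fun_prop) _ _]
    rw [Finset.sum_eq_single_of_mem l hl]
    · simp; ring
    · intro l' _ hne
      exact integral_cos_two_pi_mul_int (sub_ne_zero.2 hne.symm) N
  rw [Finset.sum_congr rfl this]
  simp
  ring

/-- After rescaling, `[-cB, cB]` is enlarged to integer endpoints. Since `c ≥ 1` this loses a
bounded factor, so the bound is uniform in the size `c` of the frequency. -/
theorem integral_norm_sq_dirichletSum_mul_le (L : ℕ) {B c : ℝ} (hB : 0 ≤ B) (hc : 1 ≤ c) :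
    ∫ y in -B..B, ‖dirichletSum L (c * y)‖ ^ 2 ≤ 2 * (B + 1) * L := by
  have hc0 : 0 < c := one_pos.trans_le hc
  rw [intervalIntegral.integral_comp_mul_left (f := fun y => ‖dirichletSum L y‖ ^ 2) hc0.ne',
    smul_eq_mul]
  have hN : c * B ≤ ⌈c * B⌉₊ := Nat.le_ceil _
  have hN' : (⌈c * B⌉₊ : ℝ) ≤ c * (B + 1) := by
    have := (Nat.ceil_lt_add_one (by positivity : 0 ≤ c * B)).le
    linarith
  have hcont := continuous_dirichletSum L
  have h1 : ∫ y in c * -B..c * B, ‖dirichletSum L y‖ ^ 2 ≤ 2 * ⌈c * B⌉₊ * L := by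
    rw [← integral_norm_sq_dirichletSum]
    refine intervalIntegral.integral_mono_interval (by linarith) (by nlinarith) hN
      (Eventually.of_forall fun y => by positivity)
      (Continuous.intervalIntegrable (by fun_prop) _ _)
  calc _ ≤ c⁻¹ * (2 * (c * (B + 1)) * L) := by
        refine mul_le_mul_of_nonneg_left (h1.trans ?_) (by positivity)
        gcongr
    _ = _ := by field_simp

/-! ### Change of variables and linear algebra for the mean square bound. -/

/-- Lebesgue measure on `ℝ ^ d` is the `d`-dimensional Hausdorff measure, so taking preimages under
`Ψ` enlarges it by at most `c ^ d`. No Jacobian is needed. -/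
theorem lintegral_comp_le_of_antilipschitzOn {d : ℕ} {s t : Set (Fin d → ℝ)}
    (hs : MeasurableSet s) {Ψ : (Fin d → ℝ) → (Fin d → ℝ)}
    (hcont : ContinuousOn Ψ s) {c : NNReal}
    (hΨ : ∀ x ∈ s, ∀ y ∈ s, edist x y ≤ c * edist (Ψ x) (Ψ y)) (hmaps : MapsTo Ψ s t)
    {h : (Fin d → ℝ) → ENNReal} (hh : Measurable h) :
    ∫⁻ x in s, h (Ψ x) ≤ (c : ENNReal) ^ d * ∫⁻ y in t, h y := by
  have hae : AEMeasurable Ψ (volume.restrict s) := hcont.aemeasurable hs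
  rw [← lintegral_map' hh.aemeasurable hae, ← lintegral_const_mul _ hh]
  have hle : (volume.restrict s).map Ψ ≤ ((c : ENNReal) ^ d) • (volume.restrict t) := by
    refine Measure.le_intro fun E hE _ => ?_
    rw [Measure.map_apply_of_aemeasurable hae hE, Measure.smul_apply, smul_eq_mul,
      Measure.restrict_apply hE, Measure.restrict_apply' hs]
    have hanti : AntilipschitzWith c (s.domRestrict Ψ) := fun x y => hΨ x x.2 y y.2
    have h1 := hanti.hausdorffMeasure_preimage_le (d := (d : ℝ)) (by positivity) (E ∩ t)
    have h2 : Ψ ⁻¹' E ∩ s = Subtype.val '' (s.domRestrict Ψ ⁻¹' (E ∩ t)) := by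
      ext x
      constructor
      · rintro ⟨hx, hxs⟩
        exact ⟨⟨x, hxs⟩, ⟨hx, hmaps hxs⟩, rfl⟩
      · rintro ⟨y, hy, rfl⟩
        exact ⟨hy.1, y.2⟩
    have h3 : (volume : Measure (Fin d → ℝ)) = Measure.hausdorffMeasure (d : ℝ) := by
      have := hausdorffMeasure_pi_real (ι := Fin d)
      rw [Fintype.card_fin] at this
      exact this.symm
    rw [h2, h3, isometry_subtype_coe.hausdorffMeasure_image (Or.inl (by positivity))]
    refine h1.trans_eq ?_
    rw [ENNReal.rpow_natCast]
  calc _ ≤ ∫⁻ y, h y ∂(((c : ENNReal) ^ d) • (volume.restrict t)) := lintegral_mono' hle le_rfl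
    _ = _ := by rw [lintegral_smul_measure, lintegral_const_mul _ hh, smul_eq_mul]

/-- By Fubini, each coordinate in `I` contributes `O(L)` in place of the trivial `L ^ 2`: a saving
of `L` for each of at least `k` coordinates. -/
theorem lintegral_prod_dirichletSum_le {d : ℕ} (I : Finset (Fin d)) {k L : ℕ} (hI : k ≤ I.card)
    (hL : 1 ≤ L) {B c : ℝ} (hB : 0 ≤ B) (hc : 1 ≤ c) :
    ∫⁻ y in Icc (fun _ : Fin d => -B) (fun _ => B), ENNReal.ofReal
        (∏ i, if i ∈ I then ‖dirichletSum L (c * y i)‖ ^ 2 else (L : ℝ) ^ 2) ≤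
      ENNReal.ofReal ((2 * (B + 1)) ^ d * ((L : ℝ) ^ (2 * d) / (L : ℝ) ^ k)) := by
  have hcd := continuous_dirichletSum L
  have hL' : (1 : ℝ) ≤ L := by exact_mod_cast hL
  have hcont : Continuous fun y : Fin d → ℝ =>
      ∏ i, if i ∈ I then ‖dirichletSum L (c * y i)‖ ^ 2 else (L : ℝ) ^ 2 := by
    refine continuous_finsetProd _ fun i _ => ?_
    by_cases hi : i ∈ I
    · simp only [if_pos hi]; fun_prop
    · simp only [if_neg hi]; fun_prop
  rw [← ofReal_integral_eq_lintegral_ofReal (hcont.continuousOn.integrableOn_compact isCompact_Icc)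
    (Eventually.of_forall fun y => Finset.prod_nonneg fun i _ => by
      split_ifs <;> positivity)]
  refine ENNReal.ofReal_le_ofReal ?_
  have hset : (volume : Measure (Fin d → ℝ)).restrict (Icc (fun _ : Fin d => -B) (fun _ => B)) =
      Measure.pi fun _ => volume.restrict (Icc (-B) B) := by
    rw [← Set.pi_univ_Icc, volume_pi, Measure.restrict_pi_pi]
  rw [hset, integral_fintype_prod_eq_prod
    (f := fun i (y : ℝ) => if i ∈ I then ‖dirichletSum L (c * y)‖ ^ 2 else (L : ℝ) ^ 2)]
  have hone : ∀ i, (∫ y in Icc (-B) B, if i ∈ I then ‖dirichletSum L (c * y)‖ ^ 2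
      else (L : ℝ) ^ 2) ≤ (2 * (B + 1)) * (if i ∈ I then (L : ℝ) else (L : ℝ) ^ 2) := by
    intro i
    rw [integral_Icc_eq_integral_Ioc, ← intervalIntegral.integral_of_le (by linarith)]
    by_cases hi : i ∈ I
    · simp only [if_pos hi]
      exact integral_norm_sq_dirichletSum_mul_le L hB hc
    · simp only [if_neg hi, intervalIntegral.integral_const, smul_eq_mul]
      gcongr
      linarith
  refine (Finset.prod_le_prod (fun i _ => integral_nonneg fun y => by
    dsimp only; split_ifs <;> positivity) fun i _ => hone i).trans ?_
  rw [Finset.prod_mul_distrib, Finset.prod_const, Finset.card_univ, Fintype.card_fin]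
  gcongr
  rw [le_div_iff₀ (by positivity)]
  have h1 : ∏ i, (if i ∈ I then (L : ℝ) else (L : ℝ) ^ 2) =
      (L : ℝ) ^ I.card * ((L : ℝ) ^ 2) ^ (d - I.card) := by
    rw [Finset.prod_ite, Finset.prod_const, Finset.prod_const]
    have h2 : (Finset.univ.filter fun i => i ∈ I) = I := by ext; simp
    have h3 : (Finset.univ.filter fun i => i ∉ I) = Iᶜ := by ext; simp
    rw [h2, h3, Finset.card_compl, Fintype.card_fin]
  have hId : I.card ≤ d := by simpa using I.card_le_univ
  rw [h1]
  calc _ ≤ (L : ℝ) ^ I.card * ((L : ℝ) ^ 2) ^ (d - I.card) * (L : ℝ) ^ I.card := by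
        gcongr
    _ = (L : ℝ) ^ (2 * d) := by
        rw [← pow_mul, ← pow_add, ← pow_add]
        congr 1
        omega

/-- Induction on the number of free indices: while `I` is not everything, the span of the fixed
vectors has dimension below `d`, leaving room for one more. -/
theorem LinearIndepOn.exists_linearIndependent_eqOn {d : ℕ} (I : Finset (Fin d))
    (v : Fin d → (Fin d → ℝ)) (h : LinearIndepOn ℝ v (I : Set (Fin d))) :
    ∃ v' : Fin d → (Fin d → ℝ), (∀ i ∈ I, v' i = v i) ∧ LinearIndependent ℝ v' := by
  classical
  induction hn : Iᶜ.card generalizing I v with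
  | zero =>
    have hI : I = Finset.univ := by
      rw [← compl_compl I, Finset.card_eq_zero.1 hn]; simp
    refine ⟨v, fun i _ => rfl, ?_⟩
    rw [hI, Finset.coe_univ] at h
    exact linearIndepOn_univ_iff.1 h
  | succ n ih =>
    obtain ⟨j, hj⟩ : Iᶜ.Nonempty := Finset.card_pos.1 (by omega)
    have hj' : j ∉ I := Finset.mem_compl.1 hj
    have hlt : I.card < d := by
      have := Finset.card_compl_add_card I
      rw [Fintype.card_fin] at this
      omega
    obtain ⟨y, hy⟩ : ∃ y : Fin d → ℝ, y ∉ Submodule.span ℝ (v '' (I : Set (Fin d))) := by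
      by_contra! hall
      have htop : Submodule.span ℝ (v '' (I : Set (Fin d))) = ⊤ := by
        rw [eq_top_iff]; exact fun y _ => hall y
      have h1 := finrank_span_finset_le_card (R := ℝ) (I.image v)
      rw [Finset.coe_image] at h1
      have h2 : Module.finrank ℝ (Submodule.span ℝ (v '' (I : Set (Fin d)))) = d := by
        rw [htop, finrank_top]; simp
      have h3 : (I.image v).card ≤ I.card := Finset.card_image_le
      rw [Set.finrank, h2] at h1
      omega
    have hupd : ∀ i ∈ I, Function.update v j y i = v i := fun i hi =>
      Function.update_of_ne (by rintro rfl; exact hj' hi) _ _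
    obtain ⟨v', h1, h2⟩ := ih (insert j I) (Function.update v j y) (by
      rw [Finset.coe_insert, linearIndepOn_insert (by simpa using hj')]
      refine ⟨h.congr fun i hi => (hupd i hi).symm, ?_⟩
      rw [Function.update_self, Set.image_congr hupd]
      exact hy) (by
      rw [Finset.compl_insert, Finset.card_erase_of_mem hj, hn]; rfl)
    exact ⟨v', fun i hi => (h1 i (Finset.mem_insert_of_mem hi)).trans (hupd i hi), h2⟩

/-- A square matrix of rank at least `k` agrees with an invertible matrix on at least `k` columns
(here written as the rows of the transposed matrix). -/
theorem Matrix.exists_isUnit_row_eq_col {d k : ℕ} (H : Matrix (Fin d) (Fin d) ℝ) (h : k ≤ H.rank) :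
    ∃ (I : Finset (Fin d)) (V : Matrix (Fin d) (Fin d) ℝ), k ≤ I.card ∧ IsUnit V ∧
      ∀ i ∈ I, ∀ l, V i l = H l i := by
  classical
  obtain ⟨κ, a, ha, hspan, hli⟩ := exists_linearIndependent' ℝ H.col
  have : Finite κ := Finite.of_injective a ha
  have := Fintype.ofFinite κ
  have hcard : k ≤ (Finset.univ.image a).card := by
    rw [Finset.card_image_of_injective _ ha, Finset.card_univ, ← finrank_span_eq_card hli, hspan,
      ← Matrix.rank_eq_finrank_span_cols]
    exact h
  have hon : LinearIndepOn ℝ H.col ((Finset.univ.image a : Finset (Fin d)) : Set (Fin d)) := by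
    rw [Finset.coe_image, Finset.coe_univ, image_univ, linearIndepOn_range_iff ha]
    exact hli
  obtain ⟨v', h1, h2⟩ := hon.exists_linearIndependent_eqOn
  refine ⟨Finset.univ.image a, Matrix.of v', hcard,
    Matrix.linearIndependent_rows_iff_isUnit.1 h2, fun i hi l => ?_⟩
  exact congrFun (h1 i hi) l

theorem abs_dotProduct_le {m : ℕ} (t y : Fin m → ℝ) : |t ⬝ᵥ y| ≤ m * ‖t‖ * ‖y‖ := by
  refine (Finset.abs_sum_le_sum_abs _ _).trans ?_
  calc ∑ i, |t i * y i| ≤ ∑ _i : Fin m, ‖t‖ * ‖y‖ := by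
        refine Finset.sum_le_sum fun i _ => ?_
        rw [abs_mul]
        exact mul_le_mul (norm_le_pi_norm t i) (norm_le_pi_norm y i) (abs_nonneg _) (norm_nonneg _)
    _ = _ := by simp; ring

theorem norm_sq_boxSum_le {d : ℕ} (I : Finset (Fin d)) (L : ℕ) {ξ y : Fin d → ℝ}
    (h : ∀ i ∈ I, ξ i = y i) :
    ‖boxSum L ξ‖ ^ 2 ≤ ∏ i, if i ∈ I then ‖dirichletSum L (y i)‖ ^ 2 else (L : ℝ) ^ 2 := by
  rw [boxSum_eq_prod, norm_prod, ← Finset.prod_pow]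
  refine Finset.prod_le_prod (fun i _ => by positivity) fun i _ => ?_
  split_ifs with hi
  · rw [h i hi]
  · gcongr
    exact norm_dirichletSum_le L _

theorem ContinuousOn.exists_norm_sub_le_on_closedBall {X G : Type*} [PseudoMetricSpace X]
    [SeminormedAddCommGroup G] {φ : X → G} {s : Set X} (hφ : ContinuousOn φ s) {x : X} (hx : x ∈ s)
    {η : ℝ} (hη : 0 < η) : ∃ r > 0, ∀ y ∈ s ∩ Metric.closedBall x r, ‖φ y - φ x‖ ≤ η := by
  have h1 := tendsto_iff_norm_sub_tendsto_zero.1 (hφ x hx)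
  obtain ⟨r, hr, h⟩ := Metric.mem_nhdsWithin_iff.1 (h1.eventually_le_const hη)
  exact ⟨r / 2, by positivity, fun y hy =>
    h ⟨Metric.closedBall_subset_ball (by linarith) hy.2, hy.1⟩⟩

/-! ### Mean squares of box sums along the gradient map. -/

section Averaging

variable {d m : ℕ} {a b : Fin d → ℝ} {D : (Fin d → ℝ) → (Fin d → ℝ) →L[ℝ] (Fin m → ℝ)}
  {D' : (Fin d → ℝ) → (Fin d → ℝ) →L[ℝ] (Fin d → ℝ) →L[ℝ] (Fin m → ℝ)}

/-- `Ψ` takes the components of `t · D α` with indices in `I` as new coordinates and completes them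
by linear ones. Its derivative stays near the invertible `L₀`, so it is antilipschitz uniformly for
`t` near `t₀`. The factor `c` is kept out of `Ψ` and absorbed by the one-dimensional integrals,
hence the uniformity in `c`. -/
theorem lintegral_norm_sq_boxSum_le_of_near {k : ℕ}
    (hD : ∀ α ∈ Icc a b, HasFDerivWithinAt D (D' α) (Icc a b) α)
    (hD' : ContinuousOn D' (Icc a b)) {α₀ : Fin d → ℝ} (hα₀ : α₀ ∈ Icc a b) {t₀ : Fin m → ℝ}
    (hrank : k ≤ (Matrix.of fun i j =>
      t₀ ⬝ᵥ D' α₀ (Pi.single i 1) (Pi.single j 1) : Matrix (Fin d) (Fin d) ℝ).rank) :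
    ∃ V ∈ 𝓝 t₀, ∃ r > 0, ∃ C : ℝ, ∀ t ∈ V, ‖t‖ = 1 → ∀ c : ℝ, 1 ≤ c → ∀ L : ℕ, 1 ≤ L →
      ∫⁻ α in Icc a b ∩ Metric.closedBall α₀ r, ENNReal.ofReal
        (‖boxSum L (fun i => (c • t) ⬝ᵥ D α (Pi.single i 1))‖ ^ 2) ≤
      ENNReal.ofReal (C * ((L : ℝ) ^ (2 * d) / (L : ℝ) ^ k)) := by
  classical
  obtain ⟨I, W, hIk, hW, hWI⟩ := Matrix.exists_isUnit_row_eq_col _ hrank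
  have hinj : (Matrix.toLin' W).ker = ⊥ := by
    rw [LinearMap.ker_eq_bot]
    exact Matrix.mulVec_injective_iff_isUnit.2 hW
  obtain ⟨κ, hκ, hanti⟩ := (Matrix.toLin' W).exists_antilipschitzWith hinj
  set L₀ : (Fin d → ℝ) →L[ℝ] (Fin d → ℝ) := LinearMap.toContinuousLinearMap (Matrix.toLin' W)
    with hL₀
  have hL₀apply : ∀ v i, L₀ v i = ∑ l, W i l * v l := fun v i => by
    simp [hL₀, Matrix.mulVec, dotProduct]
  have hL₀I : ∀ i ∈ I, ∀ v, L₀ v i = t₀ ⬝ᵥ D' α₀ v (Pi.single i 1) := by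
    intro i hi v
    have hv : D' α₀ v = ∑ l, v l • D' α₀ (Pi.single l 1) := by
      conv_lhs => rw [pi_eq_sum_univ' v]
      rw [map_sum]
      refine Finset.sum_congr rfl fun l _ => ?_
      rw [map_smul]
    rw [hL₀apply, hv, sum_apply, dotProduct_sum]
    refine Finset.sum_congr rfl fun l _ => ?_
    rw [hWI i hi l, smul_apply, dotProduct_smul, smul_eq_mul, mul_comm]
    rfl
  have hκ' : (0 : ℝ) < κ := hκ
  obtain ⟨ε, hε, hεκ⟩ : ∃ ε : ℝ, 0 < ε ∧ κ * ε ≤ 1 / 2 :=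
    ⟨1 / (2 * κ), by positivity, by field_simp; rfl⟩
  -- `η` controls the variation of `D'` near `α₀` and `τ` that of `t` near `t₀`; each is to
  -- contribute at most `ε / 2`, the `m + 1` absorbing the factor `m` from `abs_dotProduct_le`.
  set η : ℝ := ε / (2 * (m + 1)) with hη
  have hηpos : 0 < η := by positivity
  set τ : ℝ := ε / (2 * (m + 1) * (‖D' α₀‖ + 1)) with hτ
  have hτpos : 0 < τ := by positivity
  obtain ⟨r, hr, hrη⟩ : ∃ r > 0, ∀ α ∈ Icc a b ∩ Metric.closedBall α₀ r,
      ‖D' α - D' α₀‖ ≤ η := by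
    exact ContinuousOn.exists_norm_sub_le_on_closedBall
      (G := (Fin d → ℝ) →L[ℝ] (Fin d → ℝ) →L[ℝ] (Fin m → ℝ)) hD' hα₀ hηpos
  set s := Icc a b ∩ Metric.closedBall α₀ r with hs
  have hsconv : Convex ℝ s := (convex_Icc a b).inter (convex_closedBall _ _)
  have hsmeas : MeasurableSet s := measurableSet_Icc.inter measurableSet_closedBall
  have hDs : ∀ α ∈ s, HasFDerivWithinAt D (D' α) s α := fun α hα =>
    (hD α hα.1).mono inter_subset_left
  have hDcont : ContinuousOn D (Icc a b) := fun α hα => (hD α hα).continuousWithinAt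
  obtain ⟨BD, hBD⟩ := isCompact_Icc.exists_bound_of_continuousOn hDcont
  obtain ⟨A, hA⟩ := isCompact_Icc.exists_bound_of_continuousOn
    (continuousOn_id (s := Icc a b))
  have hBD0 : 0 ≤ BD := (norm_nonneg _).trans (hBD α₀ hα₀)
  have hA0 : 0 ≤ A := (norm_nonneg _).trans (hA α₀ hα₀)
  set B : ℝ := m * BD + ‖L₀‖ * A with hB
  have hB0 : 0 ≤ B := by positivity
  have hsingle : ∀ i : Fin d, ‖(Pi.single i 1 : Fin d → ℝ)‖ = 1 := fun i => by
    rw [Pi.norm_single, norm_one]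
  refine ⟨Metric.ball t₀ τ, Metric.ball_mem_nhds _ hτpos, r, hr,
    (2 * κ) ^ d * (2 * (B + 1)) ^ d, fun t ht htn c hc L hL => ?_⟩
  let Ψ : (Fin d → ℝ) → (Fin d → ℝ) := fun α i =>
    if i ∈ I then t ⬝ᵥ D α (Pi.single i 1) else L₀ α i
  have hdot : Continuous fun y : Fin m → ℝ => t ⬝ᵥ y := by
    unfold dotProduct; fun_prop
  have hΨcont : ContinuousOn Ψ s := by
    refine continuousOn_pi.2 fun i => ?_
    by_cases hi : i ∈ I
    · simp only [Ψ, if_pos hi]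
      exact hdot.comp_continuousOn
        ((hDcont.mono inter_subset_left).clm_apply continuousOn_const)
    · simp only [Ψ, if_neg hi]
      exact ((continuous_apply i).comp L₀.continuous).continuousOn
  have hΨanti : ∀ x ∈ s, ∀ y ∈ s, dist x y ≤ (2 * κ) * dist (Ψ x) (Ψ y) := by
    intro x hx y hy
    have h1 : ‖D x - D y - D' α₀ (x - y)‖ ≤ η * ‖x - y‖ :=
      Convex.norm_image_sub_le_of_norm_hasFDerivWithin_le' hDs hrη hsconv hy hx
    have h2 : ‖Ψ x - Ψ y - L₀ (x - y)‖ ≤ ε * ‖x - y‖ := by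
      refine (pi_norm_le_iff_of_nonneg (by positivity)).2 fun i => ?_
      by_cases hi : i ∈ I
      · have e : (Ψ x - Ψ y - L₀ (x - y)) i =
            t ⬝ᵥ (D x - D y - D' α₀ (x - y)) (Pi.single i 1) +
              (t - t₀) ⬝ᵥ D' α₀ (x - y) (Pi.single i 1) := by
          simp only [Pi.sub_apply, hL₀I i hi, Ψ, if_pos hi, sub_apply,
            dotProduct_sub, sub_dotProduct]
          ring
        rw [e, Real.norm_eq_abs]
        have e1 : |t ⬝ᵥ (D x - D y - D' α₀ (x - y)) (Pi.single i 1)| ≤ m * (η * ‖x - y‖) := by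
          refine (abs_dotProduct_le _ _).trans ?_
          rw [htn, mul_one]
          have h3 := (D x - D y - D' α₀ (x - y)).le_opNorm (Pi.single i 1)
          rw [hsingle, mul_one] at h3
          have h4 := h3.trans h1
          gcongr
        have e2 : |(t - t₀) ⬝ᵥ D' α₀ (x - y) (Pi.single i 1)| ≤
            m * τ * (‖D' α₀‖ * ‖x - y‖) := by
          refine (abs_dotProduct_le _ _).trans ?_
          have h3 : ‖t - t₀‖ ≤ τ := by rw [← dist_eq_norm]; exact (Metric.mem_ball.1 ht).le
          have h4 := (D' α₀ (x - y)).le_opNorm (Pi.single i 1)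
          rw [hsingle, mul_one] at h4
          have h5 := h4.trans ((D' α₀).le_opNorm (x - y))
          gcongr
        have e3 : m * η ≤ ε / 2 := by
          rw [hη, ← mul_div_assoc, div_le_iff₀ (by positivity)]
          nlinarith
        have e4 : m * τ * ‖D' α₀‖ ≤ ε / 2 := by
          have h5 : (m : ℝ) * ‖D' α₀‖ ≤ (m + 1) * (‖D' α₀‖ + 1) := by
            gcongr <;> linarith
          calc m * τ * ‖D' α₀‖ = (m * ‖D' α₀‖) * τ := by ring
            _ ≤ ((m + 1) * (‖D' α₀‖ + 1)) * τ := by gcongr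
            _ = ε / 2 := by rw [hτ]; field_simp
        calc _ ≤ m * (η * ‖x - y‖) + m * τ * (‖D' α₀‖ * ‖x - y‖) :=
              (abs_add_le _ _).trans (add_le_add e1 e2)
          _ = (m * η + m * τ * ‖D' α₀‖) * ‖x - y‖ := by ring
          _ ≤ ε * ‖x - y‖ := by gcongr; linarith
      · have e : (Ψ x - Ψ y - L₀ (x - y)) i = 0 := by
          simp only [Pi.sub_apply, Ψ, if_neg hi, map_sub, sub_self]
        rw [e, norm_zero]
        positivity
    have h3 := hanti.le_mul_dist x y
    have h4 : dist (Matrix.toLin' W x) (Matrix.toLin' W y) ≤ dist (Ψ x) (Ψ y) + ε * dist x y := by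
      have h5 : Matrix.toLin' W x - Matrix.toLin' W y = L₀ (x - y) := by
        rw [map_sub]; rfl
      rw [dist_eq_norm, h5, dist_eq_norm, dist_eq_norm]
      calc ‖L₀ (x - y)‖ = ‖(Ψ x - Ψ y) - (Ψ x - Ψ y - L₀ (x - y))‖ := by congr 1; abel
        _ ≤ _ := (norm_sub_le _ _).trans (by gcongr)
    have h6 : dist x y ≤ κ * dist (Ψ x) (Ψ y) + (κ * ε) * dist x y := by
      calc _ ≤ κ * (dist (Ψ x) (Ψ y) + ε * dist x y) := h3.trans (by gcongr)
        _ = _ := by ring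
    have h7 : (κ * ε) * dist x y ≤ 1 / 2 * dist x y := by gcongr
    linarith
  have hmaps : MapsTo Ψ s (Icc (fun _ => -B) (fun _ => B)) := by
    intro α hα
    have hall : ∀ i, |Ψ α i| ≤ B := by
      intro i
      by_cases hi : i ∈ I
      · simp only [Ψ, if_pos hi]
        refine (abs_dotProduct_le _ _).trans ?_
        rw [htn, mul_one]
        have h0 := (D α).le_opNorm (Pi.single i 1)
        rw [hsingle, mul_one] at h0
        have h1 := h0.trans (hBD α hα.1)
        calc (m : ℝ) * _ ≤ m * BD := by gcongr
          _ ≤ B := by rw [hB]; linarith [mul_nonneg (norm_nonneg L₀) hA0]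
      · simp only [Ψ, if_neg hi]
        have h1 : ‖L₀ α‖ ≤ ‖L₀‖ * A := (L₀.le_opNorm α).trans (by gcongr; exact hA α hα.1)
        calc |L₀ α i| ≤ ‖L₀ α‖ := norm_le_pi_norm (L₀ α) i
          _ ≤ B := by rw [hB]; linarith [mul_nonneg (Nat.cast_nonneg (α := ℝ) m) hBD0]
    exact ⟨fun i => (abs_le.1 (hall i)).1, fun i => (abs_le.1 (hall i)).2⟩
  have hmeas : Measurable fun y : Fin d → ℝ => ENNReal.ofReal
      (∏ i, if i ∈ I then ‖dirichletSum L (c * y i)‖ ^ 2 else (L : ℝ) ^ 2) := by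
    have hcd := continuous_dirichletSum L
    refine (ENNReal.continuous_ofReal.comp (continuous_finsetProd _ fun i _ => ?_)).measurable
    by_cases hi : i ∈ I
    · simp only [if_pos hi]; fun_prop
    · simp only [if_neg hi]; fun_prop
  calc _ ≤ ∫⁻ α in s, ENNReal.ofReal
        (∏ i, if i ∈ I then ‖dirichletSum L (c * Ψ α i)‖ ^ 2 else (L : ℝ) ^ 2) := by
        refine lintegral_mono fun α => ENNReal.ofReal_le_ofReal ?_
        refine norm_sq_boxSum_le I L (y := fun i => c * Ψ α i) fun i hi => ?_
        simp only [Ψ, if_pos hi, smul_dotProduct, smul_eq_mul]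
    _ ≤ ((2 * κ : NNReal) : ENNReal) ^ d *
          ∫⁻ y in Icc (fun _ : Fin d => -B) (fun _ => B), ENNReal.ofReal
            (∏ i, if i ∈ I then ‖dirichletSum L (c * y i)‖ ^ 2 else (L : ℝ) ^ 2) :=
        lintegral_comp_le_of_antilipschitzOn hsmeas hΨcont (fun x hx y hy => by
          have h1 : edist x y ≤ ENNReal.ofReal ((2 * κ) * dist (Ψ x) (Ψ y)) := by
            rw [edist_dist]; exact ENNReal.ofReal_le_ofReal (hΨanti x hx y hy)
          refine h1.trans_eq ?_
          rw [ENNReal.ofReal_mul (by positivity), ← edist_dist]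
          congr 1
          rw [show (2 * (κ : ℝ)) = ((2 * κ : NNReal) : ℝ) by push_cast; ring,
            ENNReal.ofReal_coe_nnreal]) hmaps hmeas
    _ ≤ ((2 * κ : NNReal) : ENNReal) ^ d * ENNReal.ofReal
          ((2 * (B + 1)) ^ d * ((L : ℝ) ^ (2 * d) / (L : ℝ) ^ k)) := by
        gcongr
        exact lintegral_prod_dirichletSum_le I hIk hL hB0 hc
    _ = _ := by
        rw [mul_assoc, ENNReal.ofReal_mul (p := (2 * (κ : ℝ)) ^ d) (by positivity),
          ENNReal.ofReal_pow (by positivity)]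
        congr 2
        rw [show (2 * (κ : ℝ)) = ((2 * κ : NNReal) : ℝ) by push_cast; ring,
          ENNReal.ofReal_coe_nnreal]

/-- Mean square bound, uniform in the frequency `w`, near a point where every nonzero linear
combination of the second derivatives has rank at least `k`. -/
theorem exists_lintegral_norm_sq_boxSum_le {k : ℕ}
    (hD : ∀ α ∈ Icc a b, HasFDerivWithinAt D (D' α) (Icc a b) α)
    (hD' : ContinuousOn D' (Icc a b)) {α₀ : Fin d → ℝ} (hα₀ : α₀ ∈ Icc a b)
    (hrank : ∀ t : Fin m → ℝ, t ≠ 0 → k ≤ (Matrix.of fun i j =>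
      t ⬝ᵥ D' α₀ (Pi.single i 1) (Pi.single j 1) : Matrix (Fin d) (Fin d) ℝ).rank) :
    ∃ r > 0, ∃ C : ℝ, 0 ≤ C ∧ ∀ w : Fin m → ℝ, 1 ≤ ‖w‖ → ∀ L : ℕ, 1 ≤ L →
      ∫⁻ α in Icc a b ∩ Metric.closedBall α₀ r, ENNReal.ofReal
        (‖boxSum L (fun i => w ⬝ᵥ D α (Pi.single i 1))‖ ^ 2) ≤
      ENNReal.ofReal (C * ((L : ℝ) ^ (2 * d) / (L : ℝ) ^ k)) := by
  -- Compactness of the sphere of directions makes `r` and `C` uniform; the length `‖w‖ ≥ 1` plays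
  -- the role of `c`.
  have hcpt : IsCompact (Metric.sphere (0 : Fin m → ℝ) 1) := isCompact_sphere _ _
  have key := hcpt.induction_on (p := fun T => ∃ r > 0, ∃ C : ℝ, 0 ≤ C ∧
      ∀ t ∈ T, ‖t‖ = 1 → ∀ c : ℝ, 1 ≤ c → ∀ L : ℕ, 1 ≤ L →
      ∫⁻ α in Icc a b ∩ Metric.closedBall α₀ r, ENNReal.ofReal
        (‖boxSum L (fun i => (c • t) ⬝ᵥ D α (Pi.single i 1))‖ ^ 2) ≤
      ENNReal.ofReal (C * ((L : ℝ) ^ (2 * d) / (L : ℝ) ^ k)))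
    ⟨1, one_pos, 0, le_rfl, by simp⟩
    (fun T T' hTT' ⟨r, hr, C, hC, h⟩ => ⟨r, hr, C, hC, fun t ht => h t (hTT' ht)⟩)
    (fun T T' ⟨r, hr, C, hC, h⟩ ⟨r', hr', C', hC', h'⟩ =>
      ⟨min r r', lt_min hr hr', max C C', le_max_of_le_left hC, fun t ht htn c hc L hL => by
        rcases ht with ht | ht
        · refine (lintegral_mono_set (inter_subset_inter_right _
            (Metric.closedBall_subset_closedBall (min_le_left _ _)))).trans
            ((h t ht htn c hc L hL).trans (ENNReal.ofReal_le_ofReal ?_))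
          gcongr
          exact le_max_left _ _
        · refine (lintegral_mono_set (inter_subset_inter_right _
            (Metric.closedBall_subset_closedBall (min_le_right _ _)))).trans
            ((h' t ht htn c hc L hL).trans (ENNReal.ofReal_le_ofReal ?_))
          gcongr
          exact le_max_right _ _⟩)
    (fun t₀ ht₀ => by
      have ht₀' : t₀ ≠ 0 := by
        rintro rfl
        simp at ht₀
      obtain ⟨V, hV, r, hr, C, h⟩ :=
        lintegral_norm_sq_boxSum_le_of_near hD hD' hα₀ (hrank t₀ ht₀')
      refine ⟨V, mem_nhdsWithin_of_mem_nhds hV, r, hr, max C 0, le_max_right _ _,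
        fun t ht htn c hc L hL => (h t ht htn c hc L hL).trans (ENNReal.ofReal_le_ofReal ?_)⟩
      gcongr
      exact le_max_left _ _)
  obtain ⟨r, hr, C, hC, h⟩ := key
  refine ⟨r, hr, C, hC, fun w hw L hL => ?_⟩
  have hw0 : 0 < ‖w‖ := one_pos.trans_le hw
  have hn : ‖(‖w‖⁻¹ • w)‖ = 1 := by
    rw [norm_smul, norm_inv, norm_norm, inv_mul_cancel₀ hw0.ne']
  have := h (‖w‖⁻¹ • w) (by simpa using hn) hn ‖w‖ hw L hL
  rwa [smul_smul, mul_inv_cancel₀ hw0.ne', one_smul] at this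

end Averaging

/-! ### Large sieve bound for an affine map near integer vectors. -/

theorem one_half_le_cos_two_pi_mul {x : ℝ} (hx : |x| ≤ 1 / 6) :
    1 / 2 ≤ Real.cos (2 * Real.pi * x) := by
  have hpi := Real.pi_pos
  rw [← Real.cos_pi_div_three, ← Real.cos_abs (2 * Real.pi * x), abs_mul,
    abs_of_pos (by positivity : 0 < 2 * Real.pi)]
  refine Real.cos_le_cos_of_nonneg_of_le_pi (by positivity) (by linarith) ?_
  nlinarith

/-- The integer part of `y` does not affect the characters, and every remaining phase is at most `1
/ 6`, so each term has real part at least `1 / 2`. -/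
theorem half_card_le_norm_sum_expTwoPiI {m J : ℕ} {β : ℝ} (hβ : m * ((J : ℝ) - 1) * β ≤ 1 / 6)
    {y : Fin m → ℝ} {p : Fin m → ℤ} (hp : ‖y - fun i => (p i : ℝ)‖ ≤ β) :
    (J : ℝ) ^ m / 2 ≤ ‖∑ u ∈ Fintype.piFinset fun _ : Fin m => Finset.Ico (0 : ℤ) J,
      expTwoPiI ((fun i => (u i : ℝ)) ⬝ᵥ y)‖ := by
  refine le_trans ?_ ((le_abs_self _).trans (Complex.abs_re_le_norm _))
  rw [Complex.re_sum]
  have hcard : ((Fintype.piFinset fun _ : Fin m => Finset.Ico (0 : ℤ) J).card : ℝ) =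
      (J : ℝ) ^ m := by simp
  rw [← hcard, div_eq_mul_one_div, ← nsmul_eq_mul, ← Finset.sum_const]
  refine Finset.sum_le_sum fun u hu => ?_
  have hsplit : (fun i => (u i : ℝ)) ⬝ᵥ y =
      ((∑ i, u i * p i : ℤ) : ℝ) + (fun i => (u i : ℝ)) ⬝ᵥ (y - fun i => (p i : ℝ)) := by
    rw [dotProduct_sub]
    simp [dotProduct]
  rw [hsplit, expTwoPiI_add, expTwoPiI_intCast, one_mul, expTwoPiI_re]
  refine one_half_le_cos_two_pi_mul ?_
  rcases Nat.eq_zero_or_pos m with rfl | hm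
  · simp [dotProduct]
  have hu' : ∀ i, 0 ≤ u i ∧ u i < J := fun i => Finset.mem_Ico.1 (Fintype.mem_piFinset.1 hu i)
  have hJ : (1 : ℝ) ≤ J := by
    have h1 := hu' ⟨0, hm⟩
    have h2 : 1 ≤ J := by omega
    exact_mod_cast h2
  have hun : ‖fun i => (u i : ℝ)‖ ≤ (J : ℝ) - 1 := by
    refine (pi_norm_le_iff_of_nonneg (by linarith)).2 fun i => ?_
    rw [Real.norm_eq_abs, abs_of_nonneg (by exact_mod_cast (hu' i).1)]
    have h1 : u i + 1 ≤ J := (hu' i).2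
    have h2 : (u i : ℝ) + 1 ≤ J := by exact_mod_cast h1
    linarith
  refine ((abs_dotProduct_le _ _).trans ?_).trans hβ
  have : (0 : ℝ) ≤ J - 1 := by linarith
  gcongr

/-- Every `l ∈ Λ` is a difference `x - y` in at least `M ^ d` ways: take `y` in the middle third of
the cube and `x = y + l`. -/
theorem card_mul_le_sum_sub {d M : ℕ} (Λ : Finset (Fin d → ℤ))
    (hΛ : ∀ l ∈ Λ, ∀ i, |l i| ≤ M) {h : (Fin d → ℤ) → ℝ} (h0 : ∀ l, 0 ≤ h l) {c : ℝ}
    (hc : ∀ l ∈ Λ, c ≤ h l) :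
    Λ.card * (M : ℝ) ^ d * c ≤
      ∑ x ∈ Fintype.piFinset fun _ : Fin d => Finset.Ico (0 : ℤ) (3 * M : ℕ),
        ∑ y ∈ Fintype.piFinset fun _ : Fin d => Finset.Ico (0 : ℤ) (3 * M : ℕ), h (x - y) := by
  classical
  set W := Fintype.piFinset fun _ : Fin d => Finset.Ico (M : ℤ) (2 * M : ℕ) with hW
  set X := Fintype.piFinset fun _ : Fin d => Finset.Ico (0 : ℤ) (3 * M : ℕ) with hX
  have hWcard : (W.card : ℝ) = (M : ℝ) ^ d := by
    have : ((2 * M : ℕ) : ℤ) - M = M := by push_cast; ring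
    simp only [hW, Fintype.card_piFinset, Int.card_Ico, this]
    simp
  let φ : (Fin d → ℤ) × (Fin d → ℤ) → (Fin d → ℤ) × (Fin d → ℤ) := fun p => (p.2 + p.1, p.2)
  have hinj : Set.InjOn φ ↑(Λ ×ˢ W) := by
    rintro ⟨l, w⟩ _ ⟨l', w'⟩ _ h
    simp only [φ, Prod.mk.injEq] at h
    obtain ⟨h1, rfl⟩ := h
    simpa using h1
  have hsub : (Λ ×ˢ W).image φ ⊆ X ×ˢ X := by
    intro p hp
    obtain ⟨⟨l, w⟩, hlw, rfl⟩ := Finset.mem_image.1 hp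
    obtain ⟨hl, hw⟩ := Finset.mem_product.1 hlw
    have hw' : ∀ i, (M : ℤ) ≤ w i ∧ w i < (2 * M : ℕ) := fun i =>
      Finset.mem_Ico.1 (Fintype.mem_piFinset.1 hw i)
    refine Finset.mem_product.2 ⟨Fintype.mem_piFinset.2 fun i => ?_,
      Fintype.mem_piFinset.2 fun i => ?_⟩
    · have h1 := abs_le.1 (hΛ l hl i)
      have h2 := hw' i
      simp only [φ, Pi.add_apply, Finset.mem_Ico]
      push_cast at h2 ⊢
      constructor <;> linarith
    · have h2 := hw' i
      simp only [φ, Finset.mem_Ico]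
      push_cast at h2 ⊢
      constructor <;> linarith
  calc Λ.card * (M : ℝ) ^ d * c = ∑ _p ∈ Λ ×ˢ W, c := by
        rw [Finset.sum_const, Finset.card_product, nsmul_eq_mul, Nat.cast_mul, hWcard]
    _ ≤ ∑ p ∈ Λ ×ˢ W, h ((φ p).1 - (φ p).2) := by
        refine Finset.sum_le_sum fun p hp => ?_
        have : (φ p).1 - (φ p).2 = p.1 := by simp [φ]
        rw [this]
        exact hc _ (Finset.mem_product.1 hp).1
    _ = ∑ p ∈ (Λ ×ˢ W).image φ, h (p.1 - p.2) :=
        (Finset.sum_image (f := fun p : (Fin d → ℤ) × (Fin d → ℤ) => h (p.1 - p.2)) hinj).symm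
    _ ≤ ∑ p ∈ X ×ˢ X, h (p.1 - p.2) :=
        Finset.sum_le_sum_of_subset_of_nonneg hsub fun p _ _ => h0 _
    _ = _ := Finset.sum_product _ _ _

/-- A large sieve type bound for the number of lattice points at which an affine map is close to an
integer vector. -/
theorem card_near_integers_mul_le {d m M J : ℕ} {β : ℝ} (hβ : m * ((J : ℝ) - 1) * β ≤ 1 / 6)
    (A : (Fin d → ℝ) →L[ℝ] (Fin m → ℝ)) (y₀ : Fin m → ℝ) (Λ : Finset (Fin d → ℤ))
    (hΛ : ∀ l ∈ Λ, ∀ i, |l i| ≤ M)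
    (hnear : ∀ l ∈ Λ, ∃ p : Fin m → ℤ,
      ‖y₀ + A (fun i => (l i : ℝ)) - fun i => (p i : ℝ)‖ ≤ β) :
    Λ.card * (M : ℝ) ^ d * ((J : ℝ) ^ m / 2) ^ 2 ≤
      ∑ u ∈ Fintype.piFinset fun _ : Fin m => Finset.Ico (0 : ℤ) J,
        ∑ v ∈ Fintype.piFinset fun _ : Fin m => Finset.Ico (0 : ℤ) J,
          ‖boxSum (3 * M) (fun i => (fun j => ((u j - v j : ℤ) : ℝ)) ⬝ᵥ A (Pi.single i 1))‖ ^ 2 := by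
  classical
  set U := Fintype.piFinset fun _ : Fin m => Finset.Ico (0 : ℤ) J
  set X := Fintype.piFinset fun _ : Fin d => Finset.Ico (0 : ℤ) (3 * M : ℕ)
  let r : (Fin d → ℤ) → (Fin d → ℝ) := fun l i => (l i : ℝ)
  let r' : (Fin m → ℤ) → (Fin m → ℝ) := fun l i => (l i : ℝ)
  let h : (Fin d → ℤ) → ℝ := fun l => ‖∑ u ∈ U, expTwoPiI (r' u ⬝ᵥ (y₀ + A (r l)))‖ ^ 2
  have h1 : Λ.card * (M : ℝ) ^ d * ((J : ℝ) ^ m / 2) ^ 2 ≤ ∑ x ∈ X, ∑ y ∈ X, h (x - y) := by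
    refine card_mul_le_sum_sub Λ hΛ (fun l => by positivity) fun l hl => ?_
    obtain ⟨p, hp⟩ := hnear l hl
    exact pow_le_pow_left₀ (by positivity) (half_card_le_norm_sum_expTwoPiI hβ hp) 2
  -- The shift `y₀` goes into the unimodular weights, so the resulting bound does not depend on it.
  have h2 := sum_norm_sq_gram_le U X (fun u => expTwoPiI (r' u ⬝ᵥ y₀)) (fun u => norm_expTwoPiI _)
    (fun u x => expTwoPiI (r' u ⬝ᵥ A (r x)))
  refine h1.trans (le_trans (le_of_eq ?_) (h2.trans (le_of_eq ?_)))
  · refine Finset.sum_congr rfl fun x _ => Finset.sum_congr rfl fun y _ => ?_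
    simp only [h]
    congr 2
    refine Finset.sum_congr rfl fun u _ => ?_
    rw [conj_expTwoPiI, ← expTwoPiI_add, ← expTwoPiI_add]
    congr 1
    have : r (x - y) = r x - r y := by ext i; simp [r]
    rw [this, map_sub, dotProduct_add, dotProduct_sub]
    ring
  · refine Finset.sum_congr rfl fun u _ => Finset.sum_congr rfl fun v _ => ?_
    congr 2
    refine Finset.sum_congr rfl fun x _ => ?_
    rw [conj_expTwoPiI, ← expTwoPiI_add]
    congr 1
    have hx : A (r x) = ∑ l, (x l : ℝ) • A (Pi.single l 1) := by
      conv_lhs => rw [pi_eq_sum_univ' (r x)]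
      rw [map_sum]
      refine Finset.sum_congr rfl fun l _ => ?_
      rw [map_smul]
    have huv : (fun j => ((u j - v j : ℤ) : ℝ)) = r' u - r' v := by ext i; simp [r']
    rw [huv, ← sub_eq_add_neg, ← sub_dotProduct, hx, dotProduct_sum]
    refine Finset.sum_congr rfl fun l _ => ?_
    rw [dotProduct_smul, smul_eq_mul]

theorem norm_boxSum_le {d : ℕ} (L : ℕ) (ξ : Fin d → ℝ) : ‖boxSum L ξ‖ ≤ (L : ℝ) ^ d := by
  refine (norm_sum_le _ _).trans ?_
  simp

theorem card_le_of_forall_norm_sub_le {m : ℕ} {y : Fin m → ℝ} {β : ℝ} {N : ℕ} (hβ : 2 * β ≤ N)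
    (P : Finset (Fin m → ℤ)) (hP : ∀ p ∈ P, ‖y - fun i => (p i : ℝ)‖ ≤ β) :
    P.card ≤ (N + 1) ^ m := by
  have hsub : P ⊆ Fintype.piFinset fun i => Finset.Icc ⌈y i - β⌉ ⌊y i + β⌋ := by
    intro p hp
    refine Fintype.mem_piFinset.2 fun i => Finset.mem_Icc.2 ?_
    have h1 := (norm_le_pi_norm _ i).trans (hP p hp)
    rw [Pi.sub_apply, Real.norm_eq_abs, abs_le] at h1
    exact ⟨Int.ceil_le.2 (by linarith), Int.le_floor.2 (by linarith)⟩
  refine (Finset.card_le_card hsub).trans ?_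
  rw [Fintype.card_piFinset]
  refine (Finset.prod_le_pow_card _ _ (N + 1) fun i _ => ?_).trans (by simp)
  rw [Int.card_Icc, Int.toNat_le]
  have h1 := Int.floor_le (y i + β)
  have h2 := Int.le_ceil (y i - β)
  have h3 : ((⌊y i + β⌋ + 1 - ⌈y i - β⌉ : ℤ) : ℝ) ≤ ((N + 1 : ℕ) : ℤ) := by
    push_cast
    linarith
  exact_mod_cast h3

/-- In each coordinate the worst case is `x` at an endpoint, leaving length at least `min ρ (b i - a
i) ≥ min 1 (b i - a i) * ρ`. -/
theorem exists_le_volume_Icc_inter_closedBall {d : ℕ} {a b : Fin d → ℝ} (hab : ∀ i, a i < b i) :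
    ∃ c : ℝ, 0 < c ∧ ∀ x ∈ Icc a b, ∀ ρ : ℝ, 0 < ρ → ρ ≤ 1 →
      ENNReal.ofReal (c * ρ ^ d) ≤ volume (Icc a b ∩ Metric.closedBall x ρ) := by
  refine ⟨∏ i, min 1 (b i - a i),
    Finset.prod_pos fun i _ => lt_min one_pos (sub_pos.2 (hab i)), fun x hx ρ hρ hρ1 => ?_⟩
  have hball : Metric.closedBall x ρ = Icc (fun i => x i - ρ) (fun i => x i + ρ) := by
    ext y
    rw [Metric.mem_closedBall, dist_pi_le_iff hρ.le, mem_Icc, Pi.le_def, Pi.le_def, ← forall_and]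
    refine forall_congr' fun i => ?_
    rw [Real.dist_eq, abs_le]
    constructor <;> rintro ⟨h1, h2⟩ <;> constructor <;> linarith
  rw [hball, Icc_inter_Icc, Real.volume_Icc_pi, ← ENNReal.ofReal_prod_of_nonneg]
  · refine ENNReal.ofReal_le_ofReal ?_
    have : ∏ i, min 1 (b i - a i) * ρ = (∏ i, min 1 (b i - a i)) * ρ ^ d := by
      rw [Finset.prod_mul_distrib]; simp
    rw [← this]
    refine Finset.prod_le_prod (fun i _ => mul_nonneg
      (le_min zero_le_one (sub_nonneg.2 (hab i).le)) hρ.le) fun i _ => ?_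
    have h1 := hx.1 i
    have h2 := hx.2 i
    have h3 := hab i
    have e1 : min 1 (b i - a i) * ρ ≤ ρ := by
      have := min_le_left 1 (b i - a i)
      nlinarith
    have e2 : min 1 (b i - a i) * ρ ≤ b i - a i := by
      have := min_le_right 1 (b i - a i)
      nlinarith
    simp only [Pi.sup_apply, Pi.inf_apply]
    rcases max_cases (a i) (x i - ρ) with ⟨h4, _⟩ | ⟨h4, _⟩ <;>
    rcases min_cases (b i) (x i + ρ) with ⟨h5, _⟩ | ⟨h5, _⟩ <;>
    rw [h4, h5] <;> linarith
  · intro i _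
    have h1 := hx.1 i
    have h2 := hx.2 i
    have h3 := hab i
    simp only [Pi.sup_apply, Pi.inf_apply]
    rcases max_cases (a i) (x i - ρ) with ⟨h4, _⟩ | ⟨h4, _⟩ <;>
    rcases min_cases (b i) (x i + ρ) with ⟨h5, _⟩ | ⟨h5, _⟩ <;>
    rw [h4, h5] <;> linarith

/-! ### Counting rational points near the graph. -/

section Counting

variable {d m : ℕ} {f : (Fin d → ℝ) → (Fin m → ℝ)}

open scoped Classical in
/-- Near a fixed `α`, the rational points close to the graph are counted by a lattice point problem
for the affine approximation of `f` at `α`. -/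
theorem card_filter_near_mul_le {α : Fin d → ℝ} {A : (Fin d → ℝ) →L[ℝ] (Fin m → ℝ)} {C : ℝ}
    (hC : 0 ≤ C) (hA : ‖A‖ ≤ C) {q : ℕ} {δ ρ : ℝ} (hδ0 : 0 < δ) (hδ : δ ≤ 1)
    (hqρ : q * ρ ^ 2 = δ) (hqρ1 : 1 ≤ q * ρ) {θ₁ : Fin d → ℝ} {θ₂ : Fin m → ℝ}
    (P : Finset ((Fin d → ℤ) × (Fin m → ℤ))) {x : (Fin d → ℤ) × (Fin m → ℤ) → Fin d → ℝ}
    (hfx : ∀ p ∈ P, ‖f (x p) - f α - A (x p - α)‖ ≤ C * ‖x p - α‖ ^ 2)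
    (h1 : ∀ p ∈ P, ‖(q : ℝ) • x p - θ₁ - fun i => (p.1 i : ℝ)‖ ≤ δ)
    (h2 : ∀ p ∈ P, ‖(q : ℝ) • f (x p) - θ₂ - fun i => (p.2 i : ℝ)‖ ≤ δ) :
    ((P.filter fun p => ‖x p - α‖ ≤ ρ).card : ℝ) * ((⌈3 * (q * ρ)⌉₊ : ℝ) ^ d *
        ((⌈1 / (6 * (m + 1) * ((2 * C + 1) * δ))⌉₊ : ℝ) ^ m / 2) ^ 2) ≤
      ((⌈2 * (2 * C + 1)⌉₊ : ℝ) + 1) ^ m *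
      ∑ u ∈ Fintype.piFinset fun _ : Fin m =>
          Finset.Ico (0 : ℤ) ⌈1 / (6 * (m + 1) * ((2 * C + 1) * δ))⌉₊,
        ∑ v ∈ Fintype.piFinset fun _ : Fin m =>
            Finset.Ico (0 : ℤ) ⌈1 / (6 * (m + 1) * ((2 * C + 1) * δ))⌉₊,
          ‖boxSum (3 * ⌈3 * (q * ρ)⌉₊)
            (fun i => (fun j => ((u j - v j : ℤ) : ℝ)) ⬝ᵥ A (Pi.single i 1))‖ ^ 2 := by
  -- The three errors: `δ` from `h2`, `q C ρ² = C δ` from the Taylor remainder, and `C δ` from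
  -- replacing `q x p - θ₁` by the integer vector `p.1` under `A`.
  set β : ℝ := (2 * C + 1) * δ with hβ
  have hβ0 : 0 < β := by positivity
  set J := ⌈1 / (6 * (m + 1) * β)⌉₊ with hJ
  set M := ⌈3 * (q * ρ)⌉₊ with hM
  have hJβ : m * ((J : ℝ) - 1) * β ≤ 1 / 6 := by
    have e1 : (J : ℝ) - 1 ≤ 1 / (6 * (m + 1) * β) := by
      have := (Nat.ceil_lt_add_one (by positivity : 0 ≤ 1 / (6 * (m + 1) * β))).le
      linarith
    calc m * ((J : ℝ) - 1) * β ≤ m * (1 / (6 * (m + 1) * β)) * β := by gcongr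
      _ = (1 / 6) * (m / (m + 1)) := by field_simp
      _ ≤ (1 / 6) * 1 := by
          gcongr
          exact div_le_one_of_le₀ (by linarith) (by positivity)
      _ = 1 / 6 := mul_one _
  let z : Fin d → ℤ := fun i => ⌊q * α i - θ₁ i⌋
  let r : (Fin d → ℤ) → (Fin d → ℝ) := fun l i => (l i : ℝ)
  set y₀ : Fin m → ℝ := (q : ℝ) • f α - θ₂ + A (r z + θ₁ - (q : ℝ) • α) with hy₀
  set Q := P.filter fun p => ‖x p - α‖ ≤ ρ with hQ
  have hQP : ∀ p ∈ Q, p ∈ P ∧ ‖x p - α‖ ≤ ρ := fun p hp => Finset.mem_filter.1 hp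
  have hnear : ∀ p ∈ Q, ‖y₀ + A (r (p.1 - z)) - fun i => (p.2 i : ℝ)‖ ≤ β := by
    intro p hp
    obtain ⟨hpP, hpρ⟩ := hQP p hp
    have e : y₀ + A (r (p.1 - z)) - (fun i => (p.2 i : ℝ)) =
        ((q : ℝ) • f (x p) - θ₂ - fun i => (p.2 i : ℝ)) -
          (q : ℝ) • (f (x p) - f α - A (x p - α)) -
          A ((q : ℝ) • x p - θ₁ - r p.1) := by
      have : r (p.1 - z) = r p.1 - r z := by ext i; simp [r]
      simp only [hy₀, this, map_sub, map_add, map_smul, smul_sub]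
      abel
    rw [e]
    have n1 := h2 p hpP
    have n2 : ‖(q : ℝ) • (f (x p) - f α - A (x p - α))‖ ≤ C * δ := by
      rw [norm_smul, Real.norm_natCast]
      calc (q : ℝ) * _ ≤ q * (C * ρ ^ 2) := by
            gcongr
            refine (hfx p hpP).trans ?_
            gcongr
        _ = C * δ := by rw [← hqρ]; ring
    have n3 : ‖A ((q : ℝ) • x p - θ₁ - r p.1)‖ ≤ C * δ :=
      (A.le_opNorm _).trans (mul_le_mul hA (h1 p hpP) (norm_nonneg _) hC)
    calc _ ≤ δ + C * δ + C * δ :=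
          (norm_sub_le _ _).trans (add_le_add ((norm_sub_le _ _).trans (add_le_add n1 n2)) n3)
      _ = β := by rw [hβ]; ring
  -- The displacement is at most `qρ + δ + 1 ≤ 3qρ`, the `1` coming from the floor.
  have hbox : ∀ p ∈ Q, ∀ i, |(p.1 - z) i| ≤ M := by
    intro p hp i
    obtain ⟨hpP, hpρ⟩ := hQP p hp
    have n1 := (norm_le_pi_norm _ i).trans (h1 p hpP)
    have n2 := (norm_le_pi_norm _ i).trans hpρ
    simp only [Pi.sub_apply, Pi.smul_apply, smul_eq_mul, Real.norm_eq_abs] at n1 n2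
    have f1 := Int.floor_le (q * α i - θ₁ i)
    have f2 := (Int.lt_floor_add_one (q * α i - θ₁ i)).le
    have n3 : |(q : ℝ) * (x p i - α i)| ≤ q * ρ := by
      rw [abs_mul, Nat.abs_cast]
      gcongr
    rw [abs_le] at n1 n3
    have hle : 3 * (q * ρ) ≤ M := Nat.le_ceil _
    have : |(((p.1 - z) i : ℤ) : ℝ)| ≤ (M : ℝ) := by
      rw [Pi.sub_apply, Int.cast_sub, abs_le]
      change -(M : ℝ) ≤ p.1 i - (⌊q * α i - θ₁ i⌋ : ℝ) ∧ p.1 i - (⌊q * α i - θ₁ i⌋ : ℝ) ≤ M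
      constructor <;> nlinarith
    exact_mod_cast this
  set Λ := Q.image fun p => p.1 - z with hΛ
  -- For fixed `p.1` the vector `p.2` is within `β ≤ 2C + 1` of a fixed point, so fibres over `Λ`
  -- are bounded.
  have hcardQ : Q.card ≤ (⌈2 * (2 * C + 1)⌉₊ + 1) ^ m * Λ.card := by
    refine Finset.card_le_mul_card_image _ _ fun l hl => ?_
    have hinj : Set.InjOn Prod.snd
        ((Q.filter fun p => p.1 - z = l : Finset ((Fin d → ℤ) × (Fin m → ℤ))) :
          Set ((Fin d → ℤ) × (Fin m → ℤ))) := by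
      intro p hp p' hp' h
      have g1 := (Finset.mem_filter.1 hp).2
      have g2 := (Finset.mem_filter.1 hp').2
      exact Prod.ext (sub_left_injective (g1.trans g2.symm)) h
    rw [← Finset.card_image_of_injOn hinj]
    refine card_le_of_forall_norm_sub_le (y := y₀ + A (r l)) (β := β) ?_ _ ?_
    · refine le_trans ?_ (Nat.le_ceil _)
      rw [hβ]
      nlinarith
    · intro s hs
      obtain ⟨p, hp, rfl⟩ := Finset.mem_image.1 hs
      obtain ⟨hpQ, rfl⟩ := Finset.mem_filter.1 hp
      exact hnear p hpQ
  have hmain := card_near_integers_mul_le (M := M) (J := J) hJβ A y₀ Λ (by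
      intro l hl i
      obtain ⟨p, hp, rfl⟩ := Finset.mem_image.1 hl
      exact hbox p hp i) (by
      intro l hl
      obtain ⟨p, hp, rfl⟩ := Finset.mem_image.1 hl
      exact ⟨p.2, hnear p hp⟩)
  have hcardQ' : (Q.card : ℝ) ≤ ((⌈2 * (2 * C + 1)⌉₊ : ℝ) + 1) ^ m * Λ.card := by
    exact_mod_cast hcardQ
  calc _ ≤ (((⌈2 * (2 * C + 1)⌉₊ : ℝ) + 1) ^ m * Λ.card) *
        ((M : ℝ) ^ d * ((J : ℝ) ^ m / 2) ^ 2) := by gcongr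
    _ = ((⌈2 * (2 * C + 1)⌉₊ : ℝ) + 1) ^ m *
        (Λ.card * (M : ℝ) ^ d * ((J : ℝ) ^ m / 2) ^ 2) := by ring
    _ ≤ _ := by gcongr

/-- Diagonal pairs get the trivial bound `L ^ (2d)`. Otherwise `u - v` is a nonzero integer vector,
of norm at least `1`, and the mean square bound applies. -/
theorem lintegral_sum_norm_sq_boxSum_le {a b : Fin d → ℝ}
    {D : (Fin d → ℝ) → (Fin d → ℝ) →L[ℝ] (Fin m → ℝ)} {k : ℕ} (hD : ContinuousOn D (Icc a b))
    {C : ℝ} (hC : 0 ≤ C)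
    (hmean : ∀ w : Fin m → ℝ, 1 ≤ ‖w‖ → ∀ L : ℕ, 1 ≤ L →
      ∫⁻ α in Icc a b, ENNReal.ofReal (‖boxSum L (fun i => w ⬝ᵥ D α (Pi.single i 1))‖ ^ 2) ≤
        ENNReal.ofReal (C * ((L : ℝ) ^ (2 * d) / (L : ℝ) ^ k)))
    (J : ℕ) {L : ℕ} (hL : 1 ≤ L) :
    ∫⁻ α in Icc a b, ENNReal.ofReal
      (∑ u ∈ Fintype.piFinset fun _ : Fin m => Finset.Ico (0 : ℤ) J,
        ∑ v ∈ Fintype.piFinset fun _ : Fin m => Finset.Ico (0 : ℤ) J,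
          ‖boxSum L (fun i => (fun j => ((u j - v j : ℤ) : ℝ)) ⬝ᵥ D α (Pi.single i 1))‖ ^ 2) ≤
      ENNReal.ofReal ((J : ℝ) ^ m * (volume.real (Icc a b) * (L : ℝ) ^ (2 * d)) +
        (J : ℝ) ^ m * ((J : ℝ) ^ m * (C * ((L : ℝ) ^ (2 * d) / (L : ℝ) ^ k)))) := by
  classical
  set U := Fintype.piFinset fun _ : Fin m => Finset.Ico (0 : ℤ) J with hU
  have hUcard : (U.card : ℝ) = (J : ℝ) ^ m := by simp [hU]
  have hmeas : ∀ w : Fin m → ℝ, AEMeasurable (fun α => ENNReal.ofReal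
      (‖boxSum L (fun i => w ⬝ᵥ D α (Pi.single i 1))‖ ^ 2)) (volume.restrict (Icc a b)) := by
    intro w
    have hdot : Continuous fun y : Fin m → ℝ => w ⬝ᵥ y := by
      unfold dotProduct; fun_prop
    have h1 : ContinuousOn (fun α => (fun i => w ⬝ᵥ D α (Pi.single i 1) : Fin d → ℝ))
        (Icc a b) := continuousOn_pi.2 fun i =>
      hdot.comp_continuousOn (hD.clm_apply continuousOn_const)
    have h2 : ContinuousOn (fun α => ENNReal.ofReal
        (‖boxSum L (fun i => w ⬝ᵥ D α (Pi.single i 1))‖ ^ 2)) (Icc a b) :=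
      ENNReal.continuous_ofReal.comp_continuousOn
        (((continuous_boxSum L).comp_continuousOn h1).norm.pow 2)
    exact h2.aemeasurable measurableSet_Icc
  have hpair : ∀ u ∈ U, ∀ v ∈ U, ∫⁻ α in Icc a b, ENNReal.ofReal
      (‖boxSum L (fun i => (fun j => ((u j - v j : ℤ) : ℝ)) ⬝ᵥ D α (Pi.single i 1))‖ ^ 2) ≤
      ENNReal.ofReal ((if u = v then volume.real (Icc a b) * (L : ℝ) ^ (2 * d) else 0) +
        C * ((L : ℝ) ^ (2 * d) / (L : ℝ) ^ k)) := by
    intro u _ v _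
    by_cases huv : u = v
    · rw [if_pos huv]
      calc _ ≤ ∫⁻ α in Icc a b, ENNReal.ofReal ((L : ℝ) ^ (2 * d)) := by
            refine lintegral_mono fun α => ENNReal.ofReal_le_ofReal ?_
            rw [mul_comm 2 d, pow_mul]
            gcongr
            exact norm_boxSum_le _ _
        _ = ENNReal.ofReal (volume.real (Icc a b) * (L : ℝ) ^ (2 * d)) := by
            rw [lintegral_const, Measure.restrict_apply_univ, mul_comm,
              ENNReal.ofReal_mul measureReal_nonneg, measureReal_def,
              ENNReal.ofReal_toReal isCompact_Icc.measure_lt_top.ne]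
        _ ≤ _ := ENNReal.ofReal_le_ofReal (le_add_of_nonneg_right (by positivity))
    · rw [if_neg huv, zero_add]
      refine hmean _ ?_ L hL
      obtain ⟨j, hj⟩ := Function.ne_iff.1 huv
      refine le_trans ?_ (norm_le_pi_norm _ j)
      rw [Real.norm_eq_abs, ← Int.cast_abs]
      exact_mod_cast Int.one_le_abs (sub_ne_zero.2 hj)
  simp only [ENNReal.ofReal_sum_of_nonneg
    (fun i _ => Finset.sum_nonneg fun j _ => sq_nonneg ‖_‖),
    ENNReal.ofReal_sum_of_nonneg (fun i _ => sq_nonneg ‖_‖)]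
  rw [lintegral_finsetSum' _ fun u _ => Finset.aemeasurable_fun_sum _ fun v _ => hmeas _]
  have hu : ∀ u ∈ U, ∫⁻ α in Icc a b, ∑ v ∈ U, ENNReal.ofReal
      (‖boxSum L (fun i => (fun j => ((u j - v j : ℤ) : ℝ)) ⬝ᵥ D α (Pi.single i 1))‖ ^ 2) ≤
      ENNReal.ofReal (volume.real (Icc a b) * (L : ℝ) ^ (2 * d) +
        (J : ℝ) ^ m * (C * ((L : ℝ) ^ (2 * d) / (L : ℝ) ^ k))) := by
    intro u hu
    rw [lintegral_finsetSum' _ fun v _ => hmeas _]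
    refine (Finset.sum_le_sum fun v hv => hpair u hu v hv).trans_eq ?_
    rw [← ENNReal.ofReal_sum_of_nonneg fun v _ => by split_ifs <;> positivity]
    congr 1
    rw [Finset.sum_add_distrib, Finset.sum_ite_eq, if_pos hu, Finset.sum_const, nsmul_eq_mul,
      hUcard]
  refine (Finset.sum_le_sum hu).trans_eq ?_
  rw [← ENNReal.ofReal_sum_of_nonneg fun v _ => by positivity]
  congr 1
  rw [Finset.sum_const, nsmul_eq_mul, hUcard]
  ring

end Counting

/-- Number of shifted rational points with denominator `q` within `δ / q` of the graph of `f`. -/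
theorem exists_card_near_graph_le {d m k : ℕ} (hk : 0 < k) {f : (Fin d → ℝ) → (Fin m → ℝ)}
    {a b : Fin d → ℝ} (hab : ∀ i, a i < b i)
    {D : (Fin d → ℝ) → (Fin d → ℝ) →L[ℝ] (Fin m → ℝ)} (hD : ContinuousOn D (Icc a b))
    {C₁ : ℝ} (hC₁ : 0 ≤ C₁) (hDC : ∀ α ∈ Icc a b, ‖D α‖ ≤ C₁)
    (hf : ∀ α ∈ Icc a b, ∀ β ∈ Icc a b, ‖f β - f α - D α (β - α)‖ ≤ C₁ * ‖β - α‖ ^ 2)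
    {C₂ : ℝ} (hC₂ : 0 ≤ C₂)
    (hmean : ∀ w : Fin m → ℝ, 1 ≤ ‖w‖ → ∀ L : ℕ, 1 ≤ L →
      ∫⁻ α in Icc a b, ENNReal.ofReal (‖boxSum L (fun i => w ⬝ᵥ D α (Pi.single i 1))‖ ^ 2) ≤
        ENNReal.ofReal (C₂ * ((L : ℝ) ^ (2 * d) / (L : ℝ) ^ k))) :
    ∃ C : ℝ, 0 ≤ C ∧ ∀ q : ℕ, 1 ≤ q → ∀ δ : ℝ, 0 < δ → δ ≤ 1 →
      1 ≤ δ ^ (2 * m + k) * (q : ℝ) ^ k → ∀ (θ₁ : Fin d → ℝ) (θ₂ : Fin m → ℝ)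
      (P : Finset ((Fin d → ℤ) × (Fin m → ℤ))),
      (∀ p ∈ P, ∃ α ∈ Icc a b, ‖(q : ℝ) • α - θ₁ - fun i => (p.1 i : ℝ)‖ ≤ δ ∧
        ‖(q : ℝ) • f α - θ₂ - fun i => (p.2 i : ℝ)‖ ≤ δ) →
      (P.card : ℝ) ≤ C * (q : ℝ) ^ d * δ ^ m := by
  classical
  obtain ⟨c, hc, hvol⟩ := exists_le_volume_Icc_inter_closedBall hab
  set N : ℝ := ((⌈2 * (2 * C₁ + 1)⌉₊ : ℝ) + 1) ^ m with hN
  set V : ℝ := volume.real (Icc a b) with hV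
  have hV0 : 0 ≤ V := measureReal_nonneg
  set G : ℝ := 6 * (m + 1) * (2 * C₁ + 1) with hG
  have hG0 : 0 < G := by positivity
  -- `4` comes from the square of `J ^ m / 2`, `9 ^ d` from `L = 3M`, `4 ^ d` from `M ≤ 4R`, `G ^ m`
  -- from `1 ≤ J G δ`, and `c` from the volume of small balls in the box.
  refine ⟨4 * N * 9 ^ d * 4 ^ d * (V * G ^ m + C₂) / c, by positivity,
    fun q hq δ hδ0 hδ1 hδq θ₁ θ₂ P hP => ?_⟩
  have hq0 : (0 : ℝ) < q := by exact_mod_cast hq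
  have hq1 : (1 : ℝ) ≤ q := by exact_mod_cast hq
  have hqδ : 1 ≤ q * δ := by
    by_contra! hlt
    have e1 : (q * δ) ^ k < 1 := pow_lt_one₀ (by positivity) hlt hk.ne'
    have e2 : δ ^ (2 * m) ≤ 1 := pow_le_one₀ hδ0.le hδ1
    have e3 : δ ^ (2 * m + k) * (q : ℝ) ^ k = δ ^ (2 * m) * (q * δ) ^ k := by
      rw [pow_add, mul_pow]; ring
    have e4 : δ ^ (2 * m) * (q * δ) ^ k ≤ 1 * (q * δ) ^ k := by gcongr
    linarith
  set ρ : ℝ := √(δ / q) with hρ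
  have hρ0 : 0 < ρ := Real.sqrt_pos.2 (by positivity)
  have hρ2 : ρ ^ 2 = δ / q := Real.sq_sqrt (by positivity)
  have hqρ : q * ρ ^ 2 = δ := by rw [hρ2]; field_simp
  have hρ1 : ρ ≤ 1 := by
    refine Real.sqrt_le_iff.2 ⟨zero_le_one, ?_⟩
    rw [one_pow, div_le_one hq0]; linarith
  set R : ℝ := q * ρ with hR
  have hR0 : 0 < R := by positivity
  have hR2 : R ^ 2 = q * δ := by rw [hR, mul_pow, hρ2]; field_simp
  have hR1 : 1 ≤ R := by
    rw [← one_le_sq_iff₀ hR0.le, hR2]; exact hqδ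
  -- Since `R ^ 2 = q δ`, this is the square root of the hypothesis on `δ`.
  have hRδ : 1 ≤ R ^ k * δ ^ m := by
    rw [← one_le_sq_iff₀ (by positivity)]
    refine hδq.trans_eq ?_
    rw [mul_pow, ← pow_mul, mul_comm k 2, pow_mul, hR2, mul_pow, pow_add, ← pow_mul]
    ring
  set M := ⌈3 * R⌉₊ with hM
  have hM1 : 3 * R ≤ M := Nat.le_ceil _
  have hM4 : (M : ℝ) ≤ 4 * R := by
    have := (Nat.ceil_lt_add_one (by positivity : 0 ≤ 3 * R)).le
    linarith
  have hM0 : (0 : ℝ) < M := by linarith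
  set J := ⌈1 / (6 * (m + 1) * ((2 * C₁ + 1) * δ))⌉₊ with hJ
  have hJ1 : 1 ≤ J := Nat.one_le_iff_ne_zero.2 (Nat.ceil_pos.2 (by positivity)).ne'
  have hJ0 : (0 : ℝ) < J := by exact_mod_cast hJ1
  have hJG : 1 ≤ J * (G * δ) := by
    have e1 : 1 / (6 * (m + 1) * ((2 * C₁ + 1) * δ)) ≤ (J : ℝ) := Nat.le_ceil _
    rw [div_le_iff₀ (by positivity)] at e1
    calc (1 : ℝ) ≤ _ := e1
      _ = _ := by rw [hG]; ring
  choose! x hxK hx1 hx2 using hP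
  set W : ℝ := (M : ℝ) ^ d * ((J : ℝ) ^ m / 2) ^ 2 with hW
  have hW0 : 0 < W := by positivity
  let S : (Fin d → ℝ) → ℝ := fun α =>
    ∑ u ∈ Fintype.piFinset fun _ : Fin m => Finset.Ico (0 : ℤ) J,
      ∑ v ∈ Fintype.piFinset fun _ : Fin m => Finset.Ico (0 : ℤ) J,
        ‖boxSum (3 * M) (fun i => (fun j => ((u j - v j : ℤ) : ℝ)) ⬝ᵥ D α (Pi.single i 1))‖ ^ 2
  have hpt : ∀ α ∈ Icc a b, ((P.filter fun p => ‖x p - α‖ ≤ ρ).card : ℝ) ≤ N / W * S α := by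
    intro α hα
    have := card_filter_near_mul_le hC₁ (hDC α hα) hδ0 hδ1 hqρ hR1 P
      (fun p hp => hf α hα (x p) (hxK p hp)) hx1 hx2
    rw [div_mul_eq_mul_div, le_div_iff₀ hW0]
    exact this
  have hL : 1 ≤ 3 * M := by
    have : 0 < M := by exact_mod_cast hM0
    omega
  have hint := lintegral_sum_norm_sq_boxSum_le hD hC₂ hmean J hL
  -- Double counting: each point of `P` is seen by all `α` in a set of volume at least `c ρ ^ d`.
  have hlow : ENNReal.ofReal (P.card * (c * ρ ^ d)) ≤
      ∫⁻ α in Icc a b, ENNReal.ofReal ((P.filter fun p => ‖x p - α‖ ≤ ρ).card : ℝ) := by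
    have e1 : ∀ α, ENNReal.ofReal ((P.filter fun p => ‖x p - α‖ ≤ ρ).card : ℝ) =
        ∑ p ∈ P, (Metric.closedBall (x p) ρ).indicator (fun _ => (1 : ENNReal)) α := by
      intro α
      rw [ENNReal.ofReal_natCast, Finset.card_filter, Nat.cast_sum]
      refine Finset.sum_congr rfl fun p _ => ?_
      simp only [indicator, Metric.mem_closedBall, dist_comm α, dist_eq_norm]
      split_ifs <;> simp
    simp only [e1]
    rw [lintegral_finsetSum _ fun p _ =>
      measurable_const.indicator Metric.isClosed_closedBall.measurableSet]
    rw [ENNReal.ofReal_mul (by positivity), ENNReal.ofReal_natCast, ← nsmul_eq_mul,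
      ← Finset.sum_const]
    refine Finset.sum_le_sum fun p hp => ?_
    rw [lintegral_indicator_const Metric.isClosed_closedBall.measurableSet, one_mul,
      Measure.restrict_apply Metric.isClosed_closedBall.measurableSet, inter_comm]
    exact hvol _ (hxK p hp) ρ hρ0 hρ1
  set T : ℝ := (J : ℝ) ^ m * (V * ((3 * M : ℕ) : ℝ) ^ (2 * d)) +
    (J : ℝ) ^ m * ((J : ℝ) ^ m *
      (C₂ * (((3 * M : ℕ) : ℝ) ^ (2 * d) / ((3 * M : ℕ) : ℝ) ^ k))) with hT
  have hup : ∫⁻ α in Icc a b, ENNReal.ofReal ((P.filter fun p => ‖x p - α‖ ≤ ρ).card : ℝ) ≤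
      ENNReal.ofReal (N / W * T) := by
    calc _ ≤ ∫⁻ α in Icc a b, ENNReal.ofReal (N / W) * ENNReal.ofReal (S α) := by
          refine setLIntegral_mono' measurableSet_Icc fun α hα => ?_
          rw [← ENNReal.ofReal_mul (by positivity)]
          exact ENNReal.ofReal_le_ofReal (hpt α hα)
      _ = ENNReal.ofReal (N / W) * ∫⁻ α in Icc a b, ENNReal.ofReal (S α) :=
          lintegral_const_mul' _ _ ENNReal.ofReal_ne_top
      _ ≤ ENNReal.ofReal (N / W) * ENNReal.ofReal T := by gcongr
      _ = _ := by rw [← ENNReal.ofReal_mul (by positivity)]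
  have hT0 : 0 ≤ N / W * T := by positivity
  have hreal : P.card * (c * ρ ^ d) ≤ N / W * T :=
    (ENNReal.ofReal_le_ofReal_iff hT0).1 (hlow.trans hup)
  have hJm : 1 ≤ (J : ℝ) ^ m * (G ^ m * δ ^ m) := by
    rw [← mul_pow, ← mul_pow]; exact one_le_pow₀ hJG
  -- Both parts become comparable to `J ^ (2m) δ ^ m`: the diagonal because `J ^ m` is at least of
  -- order `δ ^ (-m)`, the rest because `L ^ (-k) ≤ δ ^ m`.
  have hT1 : T ≤ ((J : ℝ) ^ m) ^ 2 * 9 ^ d * ((M : ℝ) ^ d) ^ 2 * ((V * G ^ m + C₂) * δ ^ m) := by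
    have e1 : ((3 * M : ℕ) : ℝ) ^ (2 * d) = 9 ^ d * ((M : ℝ) ^ d) ^ 2 := by
      rw [Nat.cast_mul, mul_pow, pow_mul _ 2 d, ← pow_mul _ d 2, mul_comm d 2]
      norm_num
    have e2 : 1 / ((3 * M : ℕ) : ℝ) ^ k ≤ δ ^ m := by
      rw [div_le_iff₀ (by positivity)]
      refine hRδ.trans ?_
      rw [mul_comm]
      gcongr
      push_cast
      linarith
    have e3 : (J : ℝ) ^ m * (V * (9 ^ d * ((M : ℝ) ^ d) ^ 2)) ≤
        (J : ℝ) ^ m * (V * (9 ^ d * ((M : ℝ) ^ d) ^ 2)) * ((J : ℝ) ^ m * (G ^ m * δ ^ m)) :=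
      le_mul_of_one_le_right (by positivity) hJm
    have e4 : (J : ℝ) ^ m * ((J : ℝ) ^ m *
        (C₂ * (9 ^ d * ((M : ℝ) ^ d) ^ 2 / ((3 * M : ℕ) : ℝ) ^ k))) ≤
        (J : ℝ) ^ m * ((J : ℝ) ^ m * (C₂ * (9 ^ d * ((M : ℝ) ^ d) ^ 2 * δ ^ m))) := by
      rw [div_eq_mul_one_div (9 ^ d * ((M : ℝ) ^ d) ^ 2)]
      gcongr
    rw [hT, e1]
    calc _ ≤ _ := add_le_add e3 e4
      _ = _ := by ring
  have hfin : P.card * (c * ρ ^ d) ≤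
      4 * N * 9 ^ d * (4 * R) ^ d * ((V * G ^ m + C₂) * δ ^ m) := by
    calc _ ≤ N / W * T := hreal
      _ ≤ N / W * (((J : ℝ) ^ m) ^ 2 * 9 ^ d * ((M : ℝ) ^ d) ^ 2 *
          ((V * G ^ m + C₂) * δ ^ m)) := by gcongr
      _ = 4 * N * 9 ^ d * (M : ℝ) ^ d * ((V * G ^ m + C₂) * δ ^ m) := by
          rw [hW]; field_simp; ring
      _ ≤ _ := by gcongr
  have hρd : 0 < c * ρ ^ d := by positivity
  rw [← le_div_iff₀ hρd] at hfin
  refine hfin.trans_eq ?_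
  rw [hR, mul_pow, mul_pow]
  field_simp

/-! ### Taylor estimate and preliminaries on the box. -/

theorem uniqueDiffOn_Icc_pi {d : ℕ} {a b : Fin d → ℝ} (hab : ∀ i, a i < b i) :
    UniqueDiffOn ℝ (Icc a b) := by
  rw [← pi_univ_Icc]
  exact UniqueDiffOn.univ_pi fun i => uniqueDiffOn_Icc (hab i)

/-- The mean value inequality is applied twice, the second time on the part of `s` within `‖y - x‖`
of `x`, where `D` differs from `D x` by at most `C ‖y - x‖`. -/
theorem norm_sub_sub_fderiv_le_sq {E F : Type*} [NormedAddCommGroup E] [NormedSpace ℝ E]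
    [NormedAddCommGroup F] [NormedSpace ℝ F] {s : Set E} (hs : Convex ℝ s) {f : E → F}
    {D : E → E →L[ℝ] F} {D' : E → E →L[ℝ] E →L[ℝ] F}
    (hf : ∀ x ∈ s, HasFDerivWithinAt f (D x) s x) (hD : ∀ x ∈ s, HasFDerivWithinAt D (D' x) s x)
    {C : ℝ} (hC : ∀ x ∈ s, ‖D' x‖ ≤ C) {x y : E} (hx : x ∈ s) (hy : y ∈ s) :
    ‖f y - f x - D x (y - x)‖ ≤ C * ‖y - x‖ ^ 2 := by
  have hC0 : 0 ≤ C := (norm_nonneg (D' x)).trans (hC x hx)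
  set u := s ∩ Metric.closedBall x ‖y - x‖
  have hu : Convex ℝ u := hs.inter (convex_closedBall _ _)
  have h1 : ∀ z ∈ u, ‖D z - D x‖ ≤ C * ‖y - x‖ := fun z hz =>
    (hs.norm_image_sub_le_of_norm_hasFDerivWithin_le hD hC hx hz.1).trans (by
      gcongr
      rw [← dist_eq_norm]
      exact hz.2)
  have h2 := Convex.norm_image_sub_le_of_norm_hasFDerivWithin_le'
    (fun z (hz : z ∈ u) => (hf z hz.1).mono inter_subset_left) h1 hu
    ⟨hx, Metric.mem_closedBall_self (norm_nonneg _)⟩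
    ⟨hy, by rw [Metric.mem_closedBall, dist_eq_norm]⟩
  refine h2.trans_eq ?_
  ring

theorem distNearestInt_lt_one {n : ℕ} (x : Fin n → ℝ) : distNearestInt x < 1 := by
  have hbdd : BddBelow (range fun p : Fin n → ℤ => ‖x - fun i => (p i : ℝ)‖) :=
    ⟨0, by rintro _ ⟨p, rfl⟩; exact norm_nonneg _⟩
  refine (ciInf_le hbdd fun i => round (x i)).trans_lt ?_
  refine ((pi_norm_le_iff_of_nonneg (by norm_num : (0 : ℝ) ≤ 1 / 2)).2 fun i => ?_).trans_lt
    (by norm_num)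
  exact abs_sub_round (x i)

/-! ### Truncated radii and null sets on the graph. -/

section Null

variable {d m k : ℕ} {a b : Fin d → ℝ} {f : (Fin d → ℝ) → (Fin m → ℝ)} {g : ℝ → ℝ}

/-- The approximation exponent `(q⁻¹ log² q) ^ (k / (2m + k))`. -/
noncomputable def criticalRadius (m k q : ℕ) : ℝ :=
  ((q : ℝ)⁻¹ * Real.log q ^ 2) ^ ((k : ℝ) / (2 * m + k))

theorem criticalRadius_nonneg (m k q : ℕ) : 0 ≤ criticalRadius m k q := by
  unfold criticalRadius; positivity

/-- The left side becomes `(log² q) ^ k`, and `log q ≥ 1` because `q ≥ 3 > e`. -/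
theorem one_le_criticalRadius_pow_mul (m : ℕ) {k q : ℕ} (hk : 0 < k) (hq : 3 ≤ q) :
    1 ≤ criticalRadius m k q ^ (2 * m + k) * (q : ℝ) ^ k := by
  have hq' : (3 : ℝ) ≤ q := by exact_mod_cast hq
  have hq0 : (0 : ℝ) < q := by linarith
  have hk' : (0 : ℝ) < k := by exact_mod_cast hk
  have hlog : 1 ≤ Real.log q := by
    rw [Real.le_log_iff_exp_le hq0]
    linarith [Real.exp_one_lt_d9]
  have h1 : criticalRadius m k q ^ (2 * m + k) = ((q : ℝ)⁻¹ * Real.log q ^ 2) ^ k := by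
    rw [criticalRadius, ← Real.rpow_natCast _ (2 * m + k), ← Real.rpow_mul (by positivity),
      ← Real.rpow_natCast _ k]
    congr 1
    push_cast
    field_simp
  rw [h1, ← mul_pow]
  refine one_le_pow₀ ?_
  rw [mul_right_comm, inv_mul_cancel₀ hq0.ne', one_mul]
  exact one_le_pow₀ hlog

/-- The radius obtained from `ψ q` by truncation from below at the critical radius and from above
at `1`. -/
noncomputable def truncatedRadius (m k : ℕ) (ψ : ℕ → ℝ) (q : ℕ) : ℝ :=
  min 1 (max (ψ q) (criticalRadius m k q))

theorem truncatedRadius_nonneg (m k : ℕ) (ψ : ℕ → ℝ) (q : ℕ) : 0 ≤ truncatedRadius m k ψ q :=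
  le_min zero_le_one (le_max_of_le_right (criticalRadius_nonneg _ _ _))

theorem one_le_truncatedRadius_pow_mul (m : ℕ) {k q : ℕ} (ψ : ℕ → ℝ) (hk : 0 < k) (hq : 3 ≤ q) :
    1 ≤ truncatedRadius m k ψ q ^ (2 * m + k) * (q : ℝ) ^ k := by
  have hq1 : (1 : ℝ) ≤ q := by exact_mod_cast (by omega : 1 ≤ q)
  rcases min_choice 1 (max (ψ q) (criticalRadius m k q)) with h | h
  · rw [truncatedRadius, h, one_pow, one_mul]
    exact one_le_pow₀ hq1
  · rw [truncatedRadius, h]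
    refine (one_le_criticalRadius_pow_mul m hk hq).trans ?_
    have := criticalRadius_nonneg m k q
    gcongr
    exact le_max_right _ _

theorem truncatedRadius_pos (m : ℕ) {k q : ℕ} (ψ : ℕ → ℝ) (hk : 0 < k) (hq : 3 ≤ q) :
    0 < truncatedRadius m k ψ q := by
  refine (truncatedRadius_nonneg m k ψ q).lt_of_ne fun h => ?_
  have := one_le_truncatedRadius_pow_mul m ψ hk hq
  rw [← h, zero_pow (by omega), zero_mul] at this
  linarith

/-- By monotonicity, `g` at the truncated radius is at most its value for `ψ q` or for the critical
radius, hence at most their sum. -/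
theorem summable_pow_mul_apply_truncatedRadius {n : ℕ} (hg : IsDimensionFunction g) {ψ : ℕ → ℝ}
    (hψ : ∀ q, 0 ≤ ψ q)
    (hseries : Summable fun q : ℕ => (q : ℝ) ^ n * g ((q : ℝ)⁻¹ * criticalRadius m k q))
    (hψs : Summable fun q : ℕ => (q : ℝ) ^ n * g (ψ q / q)) :
    Summable fun q : ℕ => (q : ℝ) ^ n * g (truncatedRadius m k ψ q / q) := by
  refine (hseries.add hψs).of_nonneg_of_le (fun q => mul_nonneg (by positivity)
    (hg.nonneg (div_nonneg (truncatedRadius_nonneg _ _ _ _) (by positivity)))) fun q => ?_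
  rw [← mul_add]
  refine mul_le_mul_of_nonneg_left ?_ (by positivity)
  have hc := criticalRadius_nonneg m k q
  have g1 := hg.nonneg (show 0 ≤ (q : ℝ)⁻¹ * criticalRadius m k q by positivity)
  have g2 := hg.nonneg (show 0 ≤ ψ q / q from div_nonneg (hψ q) (by positivity))
  have hle : truncatedRadius m k ψ q ≤ max (ψ q) (criticalRadius m k q) := min_le_right _ _
  have ht := truncatedRadius_nonneg m k ψ q
  rcases max_choice (ψ q) (criticalRadius m k q) with h | h <;> rw [h] at hle
  · have : g (truncatedRadius m k ψ q / q) ≤ g (ψ q / q) :=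
      hg.monotoneOn (div_nonneg ht (by positivity)) (div_nonneg (hψ q) (by positivity))
        (by gcongr)
    linarith
  · have : g (truncatedRadius m k ψ q / q) ≤ g ((q : ℝ)⁻¹ * criticalRadius m k q) := by
      refine hg.monotoneOn (div_nonneg ht (by positivity)) (by simp only [mem_Ici]; positivity) ?_
      rw [div_eq_inv_mul]
      gcongr
    linarith

/-- A counting bound for the rational points near the graph of `f` implies that the
approximable points of the graph form a null set. -/
theorem hausdorffGaugeMeasure_approxSet_inter_eq_zero (hm : 0 < m) (hk : 0 < k) {K : Set (Fin d → ℝ)}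
    (hg : IsDimensionFunction g) (hgBar : MonotoneOn (gBar m g) (Ioi 0))
    {ψ : ℕ → ℝ} {C : ℝ}
    (hsum : Summable fun q : ℕ => (q : ℝ) ^ (d + m) * g (truncatedRadius m k ψ q / q))
    (hcard : ∀ q : ℕ, 1 ≤ q → ∀ δ : ℝ, 0 < δ → δ ≤ 1 →
      1 ≤ δ ^ (2 * m + k) * (q : ℝ) ^ k → ∀ (θ₁ : Fin d → ℝ) (θ₂ : Fin m → ℝ)
      (P : Finset ((Fin d → ℤ) × (Fin m → ℤ))),
      (∀ p ∈ P, ∃ α ∈ K, ‖(q : ℝ) • α - θ₁ - fun i => (p.1 i : ℝ)‖ ≤ δ ∧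
        ‖(q : ℝ) • f α - θ₂ - fun i => (p.2 i : ℝ)‖ ≤ δ) →
      (P.card : ℝ) ≤ C * (q : ℝ) ^ d * δ ^ m) (θ : Fin (d + m) → ℝ) :
    hausdorffGaugeMeasure (gBar m g) (approxSet ψ θ ∩ graphOver K f) = 0 := by
  classical
  set φ : ℕ → ℝ := truncatedRadius m k ψ with hφ
  have hφ0 : ∀ q, 0 ≤ φ q := truncatedRadius_nonneg m k ψ
  have hφ1 : ∀ q, φ q ≤ 1 := fun q => min_le_left _ _
  set θ₁ : Fin d → ℝ := fun i => θ (Fin.castAdd m i) with hθ₁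
  set θ₂ : Fin m → ℝ := fun i => θ (Fin.natAdd d i) with hθ₂
  let H : ℕ → Set ((Fin d → ℤ) × (Fin m → ℤ)) := fun q =>
    {p | ∃ α ∈ K, ‖(q : ℝ) • α - θ₁ - fun i => (p.1 i : ℝ)‖ ≤ φ q ∧
        ‖(q : ℝ) • f α - θ₂ - fun i => (p.2 i : ℝ)‖ ≤ φ q}
  have hHcard : ∀ q, 3 ≤ q → ∀ P : Finset ((Fin d → ℤ) × (Fin m → ℤ)), ↑P ⊆ H q →
      (P.card : ℝ) ≤ C * (q : ℝ) ^ d * φ q ^ m := fun q hq P hP =>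
    hcard q (by omega) (φ q) (truncatedRadius_pos m ψ hk hq) (hφ1 q)
      (one_le_truncatedRadius_pow_mul m ψ hk hq) θ₁ θ₂ P fun p hp => hP hp
  have hHfin : ∀ q, 3 ≤ q → (H q).Finite := by
    intro q hq
    by_contra hinf
    obtain ⟨P, hP, hPc⟩ :=
      Set.Infinite.exists_subset_card_eq hinf (⌊C * (q : ℝ) ^ d * φ q ^ m⌋₊ + 1)
    have h1 := hHcard q hq P hP
    rw [hPc] at h1
    have h2 := Nat.lt_floor_add_one (C * (q : ℝ) ^ d * φ q ^ m)
    push_cast at h1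
    linarith
  let P : ℕ → Finset ((Fin d → ℤ) × (Fin m → ℤ)) := fun q =>
    if hq : 3 ≤ q then (hHfin q hq).toFinset else ∅
  have hP : ∀ q, 3 ≤ q → (P q : Set _) = H q := fun q hq => by simp [P, dif_pos hq]
  let x : ℕ → (Fin d → ℤ) × (Fin m → ℤ) → Fin (d + m) → ℝ := fun q p =>
    (q : ℝ)⁻¹ • (θ + fun i => ((Fin.append p.1 p.2 : Fin (d + m) → ℤ) i : ℝ))
  have hmono := gBar_monotoneOn_Ici hm hg hgBar
  have hgB0 : ∀ y, 0 ≤ y → 0 ≤ gBar m g y := fun y hy =>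
    div_nonneg (hg.nonneg hy) (by positivity)
  refine hausdorffGaugeMeasure_eq_zero_of_summable hmono (gBar_zero hm g) P x
    (r := fun q => φ q / q) (fun q => div_nonneg (hφ0 q) (by positivity)) ?_ ?_ ?_
  · refine squeeze_zero (fun q => div_nonneg (hφ0 q) (by positivity)) (fun q => ?_)
      tendsto_one_div_atTop_nhds_zero_nat
    have := hφ1 q
    gcongr
  · refine (hsum.mul_left C).of_nonneg_of_le (fun q => mul_nonneg (by positivity)
      (hgB0 _ (div_nonneg (hφ0 q) (by positivity)))) fun q => ?_
    by_cases hq : 3 ≤ q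
    · have hq0 : (0 : ℝ) < q := by exact_mod_cast (by omega : 0 < q)
      have hφp : 0 < φ q := truncatedRadius_pos m ψ hk hq
      have h1 := hHcard q hq (P q) (hP q hq).le
      calc _ ≤ (C * (q : ℝ) ^ d * φ q ^ m) * gBar m g (φ q / q) :=
            mul_le_mul_of_nonneg_right h1 (hgB0 _ (by positivity))
        _ = C * ((q : ℝ) ^ (d + m) * g (φ q / q)) := by
            rw [gBar, div_pow, pow_add]
            field_simp
    · by_cases hC : 0 ≤ C
      · simp only [P, dif_neg hq, Finset.card_empty, Nat.cast_zero, zero_mul]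
        exact mul_nonneg hC (mul_nonneg (by positivity)
          (hg.nonneg (div_nonneg (hφ0 q) (by positivity))))
      -- The counting bound for the empty set at `q = 3` forces `C ≥ 0`.
      · have h1 := hHcard 3 le_rfl ∅ (by simp)
        have h2 : 0 < (3 : ℕ) ^ d * φ 3 ^ m := by
          have := truncatedRadius_pos m ψ hk (le_refl 3)
          positivity
        rw [Finset.card_empty, Nat.cast_zero, mul_assoc] at h1
        exact absurd (nonneg_of_mul_nonneg_left h1 h2) hC
  · rintro y ⟨hy, α, hα, rfl⟩
    refine (hy.and_eventually (eventually_ge_atTop 3)).mono ?_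
    rintro q ⟨hlt, hq⟩
    have hq0 : (0 : ℝ) < q := by exact_mod_cast (by omega : 0 < q)
    -- Capping at `1` loses nothing, as the distance to the nearest integer vector is always below
    -- `1`.
    have hlt' : distNearestInt ((q : ℝ) • Fin.append α (f α) - θ) < φ q :=
      lt_min (distNearestInt_lt_one _) (lt_max_of_lt_left hlt)
    obtain ⟨p, hp⟩ := exists_lt_of_ciInf_lt hlt'
    set p₁ : Fin d → ℤ := fun i => p (Fin.castAdd m i) with hp₁
    set p₂ : Fin m → ℤ := fun i => p (Fin.natAdd d i) with hp₂
    have happ : Fin.append p₁ p₂ = p := Fin.append_castAdd_natAdd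
    have hcoord : ∀ i, ‖((q : ℝ) • Fin.append α (f α) - θ - fun i => (p i : ℝ)) i‖ ≤ φ q :=
      fun i => (norm_le_pi_norm _ i).trans hp.le
    have hmem : (p₁, p₂) ∈ H q := by
      refine ⟨α, hα, (pi_norm_le_iff_of_nonneg (hφ0 q)).2 fun i => ?_,
        (pi_norm_le_iff_of_nonneg (hφ0 q)).2 fun i => ?_⟩
      · simpa [hθ₁, hp₁] using hcoord (Fin.castAdd m i)
      · simpa [hθ₂, hp₂] using hcoord (Fin.natAdd d i)
    refine ⟨(p₁, p₂), by rw [← Finset.mem_coe, hP q hq]; exact hmem, ?_⟩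
    have e : Fin.append α (f α) - x q (p₁, p₂) =
        (q : ℝ)⁻¹ • ((q : ℝ) • Fin.append α (f α) - θ - fun i => (p i : ℝ)) := by
      simp only [x, happ]
      rw [smul_sub, smul_sub, smul_smul, inv_mul_cancel₀ hq0.ne', one_smul, smul_add]
      abel
    rw [Metric.mem_closedBall, dist_eq_norm, e, norm_smul, norm_inv, Real.norm_natCast,
      div_eq_inv_mul]
    gcongr

/-- The rank condition at the single point `α₀` yields the mean square bound on a whole ball. In the
max norm its intersection with `K` is again a nondegenerate box, so the counting bound applies
there. -/
theorem exists_closedBall_hausdorffGaugeMeasure_eq_zero (hm : 0 < m) (hk : 0 < k)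
    (hab : ∀ i, a i < b i) (hf : ContDiffOn ℝ 2 f (Icc a b))
    (hg : IsDimensionFunction g) (hgBar : MonotoneOn (gBar m g) (Ioi 0)) {ψ : ℕ → ℝ}
    (hsum : Summable fun q : ℕ => (q : ℝ) ^ (d + m) * g (truncatedRadius m k ψ q / q))
    {α₀ : Fin d → ℝ} (hα₀ : α₀ ∈ Icc a b)
    (hrank : ∀ t : Fin m → ℝ, t ≠ 0 → k ≤ (hessianForm (Icc a b) f α₀ t).rank)
    (θ : Fin (d + m) → ℝ) :
    ∃ r > 0, hausdorffGaugeMeasure (gBar m g)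
      (approxSet ψ θ ∩ graphOver (Icc a b ∩ Metric.closedBall α₀ r) f) = 0 := by
  have hu := uniqueDiffOn_Icc_pi hab
  set D := fderivWithin ℝ f (Icc a b) with hD
  set D' := fderivWithin ℝ D (Icc a b) with hD'
  have hD1 : ContDiffOn ℝ 1 D (Icc a b) := hf.fderivWithin hu (by norm_num)
  have hfD : ∀ α ∈ Icc a b, HasFDerivWithinAt f (D α) (Icc a b) α := fun α hα =>
    (hf.differentiableOn (by norm_num) α hα).hasFDerivWithinAt
  have hDD : ∀ α ∈ Icc a b, HasFDerivWithinAt D (D' α) (Icc a b) α := fun α hα =>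
    (hD1.differentiableOn (by norm_num) α hα).hasFDerivWithinAt
  have hDc : ContinuousOn D (Icc a b) := hD1.continuousOn
  have hD'c : ContinuousOn D' (Icc a b) := hD1.continuousOn_fderivWithin hu (by norm_num)
  obtain ⟨B, hB⟩ := isCompact_Icc.exists_bound_of_continuousOn hDc
  obtain ⟨B', hB'⟩ := isCompact_Icc.exists_bound_of_continuousOn
    (E := (Fin d → ℝ) →L[ℝ] (Fin d → ℝ) →L[ℝ] (Fin m → ℝ)) hD'c
  have hrank' : ∀ t : Fin m → ℝ, t ≠ 0 → k ≤ (Matrix.of fun i j =>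
      t ⬝ᵥ D' α₀ (Pi.single i 1) (Pi.single j 1) : Matrix (Fin d) (Fin d) ℝ).rank := by
    intro t ht
    have : (Matrix.of fun i j => t ⬝ᵥ D' α₀ (Pi.single i 1) (Pi.single j 1)) =
        hessianForm (Icc a b) f α₀ t := by
      ext i j
      simp only [hessianForm, Matrix.of_apply]
      rw [iteratedFDerivWithin_two_apply f hu hα₀]
      rfl
    rw [this]
    exact hrank t ht
  obtain ⟨r, hr, C₂, hC₂, hmean⟩ := exists_lintegral_norm_sq_boxSum_le hDD hD'c hα₀ hrank'
  have hball : Icc a b ∩ Metric.closedBall α₀ r =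
      Icc (a ⊔ fun i => α₀ i - r) (b ⊓ fun i => α₀ i + r) := by
    rw [← Icc_inter_Icc]
    congr 1
    ext y
    rw [Metric.mem_closedBall, dist_pi_le_iff hr.le, mem_Icc, Pi.le_def, Pi.le_def, ← forall_and]
    refine forall_congr' fun i => ?_
    rw [Real.dist_eq, abs_le]
    constructor <;> rintro ⟨h1, h2⟩ <;> constructor <;> linarith
  refine ⟨r, hr, ?_⟩
  have hsub : Icc a b ∩ Metric.closedBall α₀ r ⊆ Icc a b := inter_subset_left
  rw [hball] at hsub hmean ⊢
  have hab' : ∀ i, (a ⊔ fun i => α₀ i - r) i < (b ⊓ fun i => α₀ i + r) i := by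
    intro i
    have h1 := hα₀.1 i
    have h2 := hα₀.2 i
    simp only [Pi.sup_apply, Pi.inf_apply]
    exact max_lt (lt_min (hab i) (by linarith)) (lt_min (by linarith) (by linarith))
  have hC₁ : 0 ≤ max B B' := ((norm_nonneg _).trans (hB α₀ hα₀)).trans (le_max_left _ _)
  obtain ⟨C, -, hcard⟩ := exists_card_near_graph_le hk hab' (hDc.mono hsub) hC₁
    (fun α hα => (hB α (hsub hα)).trans (le_max_left _ _))
    (fun α hα β hβ => norm_sub_sub_fderiv_le_sq (convex_Icc a b) hfD hDD
      (fun x hx => (hB' x hx).trans (le_max_right _ _)) (hsub hα) (hsub hβ)) hC₂ hmean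
  exact hausdorffGaugeMeasure_approxSet_inter_eq_zero hm hk hg hgBar hsum hcard θ

theorem hausdorffGaugeMeasure_graphOver_eq_zero {h : ℝ → ℝ} (hmono : MonotoneOn h (Ici 0))
    (h0 : h 0 = 0) (hab : ∀ i, a i < b i) (hf : ContDiffOn ℝ 1 f (Icc a b)) {Z : Set (Fin d → ℝ)}
    (hZ : Z ⊆ Icc a b) (hZ0 : hausdorffGaugeMeasure h Z = 0) :
    hausdorffGaugeMeasure h (graphOver Z f) = 0 := by
  have hu := uniqueDiffOn_Icc_pi hab
  obtain ⟨B, hB⟩ := isCompact_Icc.exists_bound_of_continuousOn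
    (hf.continuousOn_fderivWithin hu (by norm_num))
  have hLip : LipschitzOnWith (max 1 B.toNNReal) (fun α => Fin.append α (f α)) Z := by
    refine LipschitzOnWith.of_dist_le_mul fun x hx y hy => ?_
    have hf1 : dist (f x) (f y) ≤ B.toNNReal * dist x y := by
      rw [dist_eq_norm, dist_eq_norm]
      refine Convex.norm_image_sub_le_of_norm_hasFDerivWithin_le
        (fun α hα => (hf.differentiableOn (by norm_num) α hα).hasFDerivWithinAt)
        (fun α hα => (hB α hα).trans (Real.le_coe_toNNReal B)) (convex_Icc a b) (hZ hy) (hZ hx)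
    refine (dist_pi_le_iff (by positivity)).2 fun i => ?_
    rw [NNReal.coe_max, NNReal.coe_one]
    refine Fin.addCases (fun j => ?_) (fun j => ?_) i
    · simp only [Fin.append_left]
      refine (dist_le_pi_dist x y j).trans (le_mul_of_one_le_left dist_nonneg (le_max_left _ _))
    · simp only [Fin.append_right]
      refine (dist_le_pi_dist (f x) (f y) j).trans (hf1.trans ?_)
      gcongr
      exact le_max_right _ _
  exact hausdorffGaugeMeasure_image_eq_zero hmono h0 hLip hZ0

end Null

/-! ### Assembly: exceptional set and localisation. -/

theorem theorem2p1 (d m k : ℕ) (hd : 0 < d) (hm : 0 < m) (hk : 0 < k)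
    (a b : Fin d → ℝ) (hab : ∀ i, a i < b i)
    (f : (Fin d → ℝ) → (Fin m → ℝ)) (hf : ContDiffOn ℝ 2 f (Set.Icc a b))
    (g : ℝ → ℝ) (hg : IsDimensionFunction g)
    (hgBar : MonotoneOn (gBar m g) (Set.Ioi 0))
    (hseries : Summable fun q : ℕ =>
      (q : ℝ) ^ (d + m) *
        g ((q : ℝ)⁻¹ * ((q : ℝ)⁻¹ * Real.log q ^ 2) ^ ((k : ℝ) / (2 * m + k))))
    (hrank : ∀ᵐ α ∂(hausdorffGaugeMeasure (gBar m g) : MeasureTheory.Measure (Fin d → ℝ)),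
      α ∈ Set.Icc a b →
        ∀ t : Fin m → ℝ, t ≠ 0 → k ≤ (hessianForm (Set.Icc a b) f α t).rank) :
    IsStrongJarnikConvergence m (graphOver (Set.Icc a b) f) g := by
  intro ψ hψ hψs θ
  have hmono := gBar_monotoneOn_Ici hm hg hgBar
  have hsum := summable_pow_mul_apply_truncatedRadius (m := m) (k := k) hg hψ hseries hψs
  set Z : Set (Fin d → ℝ) := {α | ¬ (α ∈ Icc a b →
    ∀ t : Fin m → ℝ, t ≠ 0 → k ≤ (hessianForm (Icc a b) f α t).rank)} with hZ
  have hZK : Z ⊆ Icc a b := fun α hα => by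
    by_contra h
    exact hα fun h' => absurd h' h
  have hZ0 : hausdorffGaugeMeasure (gBar m g) Z = 0 := ae_iff.1 hrank
  have hsplit : approxSet ψ θ ∩ graphOver (Icc a b) f ⊆
      graphOver Z f ∪ approxSet ψ θ ∩ graphOver (Icc a b \ Z) f := by
    rintro y ⟨hy, α, hα, rfl⟩
    by_cases hαZ : α ∈ Z
    · exact Or.inl ⟨α, hαZ, rfl⟩
    · exact Or.inr ⟨hy, α, ⟨hα, hαZ⟩, rfl⟩
  refine measure_mono_null hsplit (measure_union_null
    (hausdorffGaugeMeasure_graphOver_eq_zero hmono (gBar_zero hm g) hab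
      (hf.of_le (by norm_num)) hZK hZ0) ?_)
  -- Every remaining point lies over some `α₀` with the rank condition, and the preimage under the
  -- projection `π` of a ball around `α₀` is a neighbourhood on which the local result applies.
  refine measure_null_of_locally_null _ ?_
  rintro _ ⟨-, α₀, ⟨hα₀, hα₀Z⟩, rfl⟩
  obtain ⟨r, hr, hnull⟩ := exists_closedBall_hausdorffGaugeMeasure_eq_zero hm hk hab hf hg hgBar
    hsum hα₀ (not_not.1 hα₀Z hα₀) θ
  let π : (Fin (d + m) → ℝ) → (Fin d → ℝ) := fun y i => y (Fin.castAdd m i)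
  have hπ : Continuous π := by fun_prop
  have hπα : ∀ α, π (Fin.append α (f α)) = α := fun α => by
    ext i; simp [π]
  refine ⟨π ⁻¹' Metric.closedBall α₀ r ∩ (approxSet ψ θ ∩ graphOver (Icc a b \ Z) f),
    inter_mem (mem_nhdsWithin_of_mem_nhds (hπ.continuousAt.preimage_mem_nhds ?_))
      self_mem_nhdsWithin, measure_mono_null ?_ hnull⟩
  · rw [hπα]
    exact Metric.closedBall_mem_nhds _ hr
  · rintro _ ⟨hy, hyS, α, hα, rfl⟩
    rw [mem_preimage, hπα] at hy
    exact ⟨hyS, α, ⟨hα.1, hy⟩, rfl⟩
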